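/- Let $0<q,q_1\le\infty$, $1\le q_0,r,r_0<\infty$, $1\le r_1\le\infty$ satisfy $1/q=1/q_0+1/q_1$ and $1/r=1/r_0+1/r_1$. Then there is a constant $C=C_{q_0,q_1,r_0,r_1}<\infty$ with the following property. Let $(\Omega,\mathcal F,\mathbb P)$ be a probability space with a filtration $(\mathcal F_n)_{n\in\mathbb N}$, $\mathbb{N}=\{0,1,2,\dots\}$. For each $k\in\mathbb Z$ let $g^{(k)}=(g^{(k)}_n)_{n\in\mathbb N}$ be a real-valued martingale, let $F^{(k)}=(F^{(k)}_{s,t})_{s\le t}$ be a real-valued two-parameter process that is adapted (that is, $F^{(k)}_{s,t}$ is $\mathcal F_t$-measurable for all $s\le t$), and let $\tau_k'\le\tau_k$ be stopping times with values in $\mathbb N\cup\{\infty\}$. Write $dg_j=g_j-g_{j-1}$, $$\Pi_{s,t}(F,g)=\sum_{s<j\le t}F_{s,j-1}\,dg_j,\qquad Sg_{s,t}=\Bigl(\sum_{s<j\le t}|dg_j|^2\Bigr)^{1/2},\qquad (\delta_sF)_{t,u}=F_{s,u}-F_{t,u},$$ $\ell^p_k a_k=(\sum_{k\in\mathbb{Z}}|a_k|^p)^{1/p}$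 for $p<\infty$ and $\ell^\infty_k a_k=\sup_{k\in\mathbb{Z}}|a_k|$, and $\|\cdot\|_p$ for the (quasi-)norm of $L^p(\Omega)$. All suprema run over integer times, and the supremum over an empty set is $0$. Then $$\Bigl\|\ell^r_k\sup_{\tau_k'\le t\le\tau_k}|\Pi_{\tau_k',t}(F^{(k)},g^{(k)})|\Bigr\|_q\le C\,\Bigl\|\ell^{r_1}_k\sup_{\tau_k'\le t<\tau_k}|F^{(k)}_{\tau_k',t}|\Bigr\|_{q_1}\Bigl\|\ell^{r_0}_k Sg^{(k)}_{\tau_k',\tau_k}\Bigr\|_{q_0}.$$ Moreover, with $$L=\Bigl\|\ell^r_k\sup_{\tau_k'\le s<t\le\tau_k}|\Pi_{s,t}(F^{(k)},g^{(k)})|\Bigr\|_q,\qquad D=\Bigl\|\ell^r_k\sup_{\tau_k'\le s<t\le\tau_k}|\Pi_{s,t}(\delta_{\tau_k'}F^{(k)},g^{(k)})|\Bigr\|_q,$$ $$B=\Bigl\|\ell^{r_1}_k\sup_{\tau_k'\le i\le j\le\tau_k}|F^{(k)}_{i,j}|\Bigr\|_{q_1}\Bigl\|\ell^{r_0}_k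 Sg^{(k)}_{\tau_k',\tau_k}\Bigr\|_{q_0},$$ one has $$L\le D+C\,B\quad\text{if }q\ge1,\qquad\qquad L^q\le D^q+(C\,B)^q\quad\text{if }q<1.$$ All quantities take values in $[0,\infty]$, with $0\cdot\infty=0$. -/

import Mathlib

open MeasureTheory
open scoped ENNReal NNReal

noncomputable section

namespace VVParaproduct

/-- The martingale difference `dg_j = g_j - g_{j-1}` (only used for `j ≥ 1`). -/
def diff (g : ℕ → ℝ) (j : ℕ) : ℝ := g j - g (j - 1)

/-- The discrete paraproduct `Π_{s,t}(F,g) = ∑_{s < j ≤ t} F_{s,j-1} dg_j`. -/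
def paraprod (F : ℕ → ℕ → ℝ) (g : ℕ → ℝ) (s t : ℕ) : ℝ :=
  ∑ j ∈ Finset.Ioc s t, F s (j - 1) * diff g j

/-- `(δ_s F)_{t,u} = F_{s,u} - F_{t,u}`. -/
def deltaFst (s : ℕ) (F : ℕ → ℕ → ℝ) : ℕ → ℕ → ℝ := fun t u => F s u - F t u

/-- The square function `Sg_{s,t} = (∑_{s < j ≤ t} |dg_j|²)^{1/2}`, with `s, t` possibly infinite. -/
def sqFun (g : ℕ → ℝ) (s t : WithTop ℕ) : ℝ≥0∞ :=
  (∑' j : {j : ℕ // s < (j : WithTop ℕ) ∧ (j : WithTop ℕ) ≤ t}, ‖diff g j‖ₑ ^ 2) ^ (1 / 2 : ℝ)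

/-- The `ℓ^r` norm, `0 < r ≤ ∞`, of a family of elements of `[0,∞]`. -/
def ellNorm {ι : Type*} (r : ℝ≥0∞) (a : ι → ℝ≥0∞) : ℝ≥0∞ :=
  if r = ∞ then ⨆ k, a k else (∑' k, a k ^ r.toReal) ^ (1 / r.toReal)

/-- `sup_{a ≤ t ≤ b} |Π_{a,t}(F,g)|`, where `t` runs through `ℕ`; the supremum is `0` if `a = ∞`
(there is no such `t` then, so that the default value in `untopD` plays no role). -/
def supParaprodFrom (F : ℕ → ℕ → ℝ) (g : ℕ → ℝ) (a b : WithTop ℕ) : ℝ≥0∞ :=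
  ⨆ (t : ℕ) (_ : a ≤ (t : WithTop ℕ) ∧ (t : WithTop ℕ) ≤ b), ‖paraprod F g (a.untopD 0) t‖ₑ

/-- `sup_{a ≤ t < b} |F_{a,t}|`, where `t` runs through `ℕ`. -/
def supFrom (F : ℕ → ℕ → ℝ) (a b : WithTop ℕ) : ℝ≥0∞ :=
  ⨆ (t : ℕ) (_ : a ≤ (t : WithTop ℕ) ∧ (t : WithTop ℕ) < b), ‖F (a.untopD 0) t‖ₑ

/-- `sup_{a ≤ s < t ≤ b} |Π_{s,t}(F,g)|`, where `s, t` run through `ℕ`. -/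
def supParaprod (F : ℕ → ℕ → ℝ) (g : ℕ → ℝ) (a b : WithTop ℕ) : ℝ≥0∞ :=
  ⨆ (s : ℕ) (t : ℕ) (_ : a ≤ (s : WithTop ℕ) ∧ s < t ∧ (t : WithTop ℕ) ≤ b),
    ‖paraprod F g s t‖ₑ

/-- `sup_{a ≤ i ≤ j ≤ b} |F_{i,j}|`, where `i, j` run through `ℕ`. -/
def supTwo (F : ℕ → ℕ → ℝ) (a b : WithTop ℕ) : ℝ≥0∞ :=
  ⨆ (i : ℕ) (j : ℕ) (_ : a ≤ (i : WithTop ℕ) ∧ i ≤ j ∧ (j : WithTop ℕ) ≤ b), ‖F i j‖ₑ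

/-- A two-parameter process `(F_{s,t})_{s ≤ t}` is adapted if `F_{s,t}` is `ℱ_t`-measurable for all
`s ≤ t`. -/
def AdaptedTwo {Ω : Type*} {m : MeasurableSpace Ω} (ℱ : Filtration ℕ m)
    (F : ℕ → ℕ → Ω → ℝ) : Prop :=
  ∀ s t : ℕ, s ≤ t → Measurable[ℱ t] (F s t)

end VVParaproduct

end

/-! Cut out by the stopping times, the increments `dg` and the integrand `F_{τ',·}` become a
martingale difference sequence `d` and adapted multipliers `f`, with the index shifted by one so
that `f j` is known before `d j` is revealed. It suffices to bound the maximal functions of the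
transforms `∑ f_j d_j` in `L^q(ℓ^r)` for finitely many `k` and finite time; monotone convergence
does the rest.

A Davis decomposition in `ℓ^{r₀}` splits `d = p + u`. The sum `∑ ‖u_j‖` is controlled in `L^{q₀}` by
the square function, so the triangle inequality and Hölder settle `u`. The increments of `p` are
bounded by four times the largest earlier increment of `d`, so the square function of the transform
of `p`, including the next increment, is dominated by a quantity already known. One can therefore
stop before it gets large, and the good-λ method turns a weak type inequality at the single exponent
`r` into an `L^q` bound for every finite `q > 0` (`eLpNorm_maxSum_le_of_weakBDG`). Together this is
`eLpNorm_transform_le_of_weakBDG`.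

The argument is run twice. Started from the weak type (2,2) inequality for one martingale
(`MDS.weak_type_two`), it gives the scalar Burkholder–Davis–Gundy inequality in `L^r`. Since the
inner and outer exponents of `L^r(ℓ^r)` coincide, `r`-th powers can be summed over `k`, which yields
the vector-valued weak type inequality (`exists_weakBDG`). The second run, started from it, gives
the mixed exponents.

The two-parameter estimate follows from the algebraic identity `Π_{s,t}(F) = Π_{τ',t}(F) -
Π_{τ',s}(F) - Π_{s,t}(δ_{τ'}F)`, whose first two terms have the left endpoint fixed. -/

namespace VVParaproduct

/-! ### `L^p` norms of `[0,∞]`-valued functions -/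

section Norms

variable {α : Type*} [MeasurableSpace α] {μ : Measure α}

theorem eLpNorm_ennreal_eq {p : ℝ≥0∞} (hp : p ≠ 0) (hp' : p ≠ ∞) (f : α → ℝ≥0∞) :
    eLpNorm f p μ = (∫⁻ a, f a ^ p.toReal ∂μ) ^ (1 / p.toReal) := by
  simp [eLpNorm_eq_lintegral_rpow_enorm_toReal hp hp']

theorem eLpNorm_ennreal_mono_ae {p : ℝ≥0∞} {f g : α → ℝ≥0∞} (h : ∀ᵐ a ∂μ, f a ≤ g a) :
    eLpNorm f p μ ≤ eLpNorm g p μ :=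
  eLpNorm_mono_enorm_ae (by simpa using h)

theorem eLpNorm_ennreal_mono {p : ℝ≥0∞} {f g : α → ℝ≥0∞} (h : ∀ a, f a ≤ g a) :
    eLpNorm f p μ ≤ eLpNorm g p μ :=
  eLpNorm_ennreal_mono_ae (.of_forall h)

theorem eLpNorm_ennreal_rpow {p : ℝ≥0∞} (hp : p ≠ 0) (hp' : p ≠ ∞) (f : α → ℝ≥0∞) :
    eLpNorm f p μ ^ p.toReal = ∫⁻ a, f a ^ p.toReal ∂μ := by
  have := ENNReal.toReal_pos hp hp'
  rw [eLpNorm_ennreal_eq hp hp', ← ENNReal.rpow_mul, one_div_mul_cancel this.ne', ENNReal.rpow_one]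

theorem eLpNorm_ennreal_add_le {p : ℝ≥0∞} (hp : 1 ≤ p) {f g : α → ℝ≥0∞}
    (hf : AEMeasurable f μ) (hg : AEMeasurable g μ) :
    eLpNorm (fun a => f a + g a) p μ ≤ eLpNorm f p μ + eLpNorm g p μ :=
  eLpNorm_add_le hf.aestronglyMeasurable hg.aestronglyMeasurable hp

theorem eLpNorm_ennreal_const_mul (p : ℝ≥0∞) (c : ℝ≥0) (f : α → ℝ≥0∞) :
    eLpNorm (fun a => c * f a) p μ = c * eLpNorm f p μ := by
  rcases eq_or_ne p 0 with rfl | hp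
  · simp
  rcases eq_or_ne p ∞ with rfl | hp'
  · simp only [eLpNorm_exponent_top, eLpNormEssSup, enorm_eq_self]
    exact ENNReal.essSup_const_mul
  have := ENNReal.toReal_pos hp hp'
  rw [eLpNorm_ennreal_eq hp hp', eLpNorm_ennreal_eq hp hp']
  simp_rw [ENNReal.mul_rpow_of_nonneg _ _ this.le]
  rw [lintegral_const_mul' _ _ (by finiteness), ENNReal.mul_rpow_of_nonneg _ _ (by positivity),
    ← ENNReal.rpow_mul, mul_one_div_cancel this.ne', ENNReal.rpow_one]

/-- Hölder's inequality for `[0,∞]`-valued functions, all exponents in `(0,∞]`. -/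
theorem eLpNorm_ennreal_mul_le {p q r : ℝ≥0∞} (hp : p ≠ 0) (hq : q ≠ 0)
    (h : 1 / r = 1 / p + 1 / q) {f g : α → ℝ≥0∞}
    (hf : AEMeasurable f μ) (hg : AEMeasurable g μ) :
    eLpNorm (fun a => f a * g a) r μ ≤ eLpNorm f p μ * eLpNorm g q μ := by
  have top_case : ∀ (s : ℝ≥0∞) (f g : α → ℝ≥0∞), AEMeasurable g μ →
      eLpNorm (fun a => f a * g a) s μ ≤ eLpNorm f ∞ μ * eLpNorm g s μ := by
    intro s f g hg
    have hle : ∀ᵐ a ∂μ, f a ≤ eLpNorm f ∞ μ := by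
      simpa [eLpNorm_exponent_top] using ae_le_eLpNormEssSup (f := f) (μ := μ)
    rcases eq_or_ne s 0 with rfl | hs
    · simp
    -- With the convention `0 * ∞ = 0`, an infinite norm of `f` gives a trivial bound only if `g` is
    -- not a.e. zero.
    rcases eq_or_ne (eLpNorm f ∞ μ) ∞ with htop | hne
    · rcases eq_or_ne (eLpNorm g s μ) 0 with h0 | h0
      · have : g =ᵐ[μ] 0 := (eLpNorm_eq_zero_iff hg.aestronglyMeasurable hs).1 h0
        rw [h0, mul_zero, nonpos_iff_eq_zero]
        refine eLpNorm_eq_zero_of_ae_zero ?_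
        filter_upwards [this] with a ha
        simp [ha]
      · rw [htop, ENNReal.top_mul h0]; exact le_top
    · lift eLpNorm f ∞ μ to ℝ≥0 using hne with c
      rw [← eLpNorm_ennreal_const_mul]
      refine eLpNorm_ennreal_mono_ae ?_
      filter_upwards [hle] with a ha
      gcongr
  rcases eq_or_ne p ∞ with rfl | hp'
  · have : r = q := by simpa using h
    subst this
    exact top_case r f g hg
  rcases eq_or_ne q ∞ with rfl | hq'
  · have : r = p := by simpa using h
    subst this
    simpa only [mul_comm] using top_case r g f hf
  have hp0 := ENNReal.toReal_pos hp hp'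
  have hq0 := ENNReal.toReal_pos hq hq'
  have h' : 1 / r.toReal = 1 / p.toReal + 1 / q.toReal := by
    have := congr(ENNReal.toReal $(h))
    rw [ENNReal.toReal_add (by simpa using hp) (by simpa using hq)] at this
    simpa using this
  have hr0 : 0 < r.toReal := one_div_pos.mp <| by rw [h']; positivity
  obtain ⟨hr1, hr2⟩ := ENNReal.toReal_pos_iff.mp hr0
  have hrp : r.toReal < p.toReal := lt_of_one_div_lt_one_div hp0 <|
    h' ▸ lt_add_of_pos_right _ (by positivity)
  rw [eLpNorm_ennreal_eq hr1.ne' hr2.ne, eLpNorm_ennreal_eq hp hp', eLpNorm_ennreal_eq hq hq']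
  exact ENNReal.lintegral_Lp_mul_le_Lq_mul_Lr hr0 hrp h' μ hf hg

end Norms

/-! ### Sequence norms -/

section EllNorm

variable {ι : Type*}

/-- Counting measure on the discrete σ-algebra transfers Minkowski, Hölder and homogeneity from
`eLpNorm`, with no measurability left to check. -/
theorem ellNorm_eq_eLpNorm {r : ℝ≥0∞} (hr : r ≠ 0) (a : ι → ℝ≥0∞) :
    ellNorm r a = @eLpNorm ι ℝ≥0∞ _ ⊤ a r (@Measure.count ι ⊤) := by
  let _ : MeasurableSpace ι := ⊤
  rw [ellNorm]
  split_ifs with h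
  · subst h
    simp [eLpNorm_exponent_top]
  · rw [eLpNorm_ennreal_eq hr h, lintegral_count]

theorem ellNorm_mono {r : ℝ≥0∞} {a b : ι → ℝ≥0∞} (h : ∀ k, a k ≤ b k) :
    ellNorm r a ≤ ellNorm r b := by
  rw [ellNorm, ellNorm]
  split_ifs
  · exact iSup_mono h
  · gcongr
    exact h _

theorem ellNorm_add_le {r : ℝ≥0∞} (hr : 1 ≤ r) (a b : ι → ℝ≥0∞) :
    ellNorm r (fun k => a k + b k) ≤ ellNorm r a + ellNorm r b := by
  let _ : MeasurableSpace ι := ⊤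
  have hr0 : r ≠ 0 := (zero_lt_one.trans_le hr).ne'
  simp only [ellNorm_eq_eLpNorm hr0]
  exact eLpNorm_ennreal_add_le hr measurable_from_top.aemeasurable measurable_from_top.aemeasurable

theorem ellNorm_const_mul {r : ℝ≥0∞} (hr : r ≠ 0) (c : ℝ≥0) (a : ι → ℝ≥0∞) :
    ellNorm r (fun k => c * a k) = c * ellNorm r a := by
  let _ : MeasurableSpace ι := ⊤
  simp only [ellNorm_eq_eLpNorm hr]
  exact eLpNorm_ennreal_const_mul r c a

theorem ellNorm_mul_le {p q r : ℝ≥0∞} (hp : p ≠ 0) (hq : q ≠ 0) (hr : r ≠ 0)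
    (h : 1 / r = 1 / p + 1 / q) (a b : ι → ℝ≥0∞) :
    ellNorm r (fun k => a k * b k) ≤ ellNorm p a * ellNorm q b := by
  let _ : MeasurableSpace ι := ⊤
  simp only [ellNorm_eq_eLpNorm hr, ellNorm_eq_eLpNorm hp, ellNorm_eq_eLpNorm hq]
  exact eLpNorm_ennreal_mul_le hp hq h measurable_from_top.aemeasurable
    measurable_from_top.aemeasurable

theorem ellNorm_zero {r : ℝ≥0∞} (hr : r ≠ 0) : ellNorm r (fun _ : ι => 0) = 0 := by
  simpa using ellNorm_const_mul hr 0 (fun _ : ι => 0)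

theorem ellNorm_sum_le {r : ℝ≥0∞} (hr : 1 ≤ r) {κ : Type*} (s : Finset κ) (a : κ → ι → ℝ≥0∞) :
    ellNorm r (fun k => ∑ j ∈ s, a j k) ≤ ∑ j ∈ s, ellNorm r (a j) := by
  classical
  induction s using Finset.induction_on with
  | empty => simp [ellNorm_zero (zero_lt_one.trans_le hr).ne']
  | insert i s hi ih =>
    simp only [Finset.sum_insert hi]
    exact (ellNorm_add_le hr _ _).trans (by gcongr)

theorem le_ellNorm {r : ℝ≥0∞} (hr : r ≠ 0) (a : ι → ℝ≥0∞) (k : ι) : a k ≤ ellNorm r a := by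
  rw [ellNorm]
  split_ifs with h
  · exact le_iSup a k
  · have := ENNReal.toReal_pos hr h
    calc a k = (a k ^ r.toReal) ^ (1 / r.toReal) := by
          rw [← ENNReal.rpow_mul, mul_one_div_cancel this.ne', ENNReal.rpow_one]
      _ ≤ _ := by gcongr; exact ENNReal.le_tsum k

theorem ellNorm_ne_top [Finite ι] {r : ℝ≥0∞} {a : ι → ℝ≥0∞} (h : ∀ k, a k ≠ ∞) :
    ellNorm r a ≠ ∞ := by
  have := Fintype.ofFinite ι
  rw [ellNorm]
  split_ifs with hr
  · refine ((Set.finite_range a).bddAbove).elim fun _ _ => ?_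
    rcases isEmpty_or_nonempty ι
    · simp
    · obtain ⟨k, hk⟩ := exists_eq_ciSup_of_finite (f := a)
      exact hk ▸ h k
  · rw [tsum_fintype]
    refine ENNReal.rpow_ne_top_of_nonneg (by positivity) (ENNReal.sum_ne_top.2 fun k _ => ?_)
    exact ENNReal.rpow_ne_top_of_nonneg (by positivity) (h k)

theorem ellNorm_unique [Unique ι] {r : ℝ≥0∞} (hr : r ≠ 0) (a : ι → ℝ≥0∞) :
    ellNorm r a = a default := by
  rw [ellNorm]
  split_ifs with h
  · simp
  · have := ENNReal.toReal_pos hr h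
    rw [tsum_fintype, Fintype.sum_unique, ← ENNReal.rpow_mul, mul_one_div_cancel this.ne',
      ENNReal.rpow_one]

theorem measurable_ellNorm [Countable ι] {Ω : Type*} {m : MeasurableSpace Ω} {r : ℝ≥0∞}
    {a : ι → Ω → ℝ≥0∞} (h : ∀ k, Measurable (a k)) :
    Measurable (fun ω => ellNorm r fun k => a k ω) := by
  simp only [ellNorm]
  split_ifs with h'
  · exact Measurable.iSup h
  · exact (Measurable.tsum fun k => (h k).pow_const _).pow_const _

theorem ellNorm_rpow [Fintype ι] {r : ℝ≥0∞} (hr : r ≠ 0) (hr' : r ≠ ∞) (a : ι → ℝ≥0∞) :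
    ellNorm r a ^ r.toReal = ∑ k, a k ^ r.toReal := by
  have := ENNReal.toReal_pos hr hr'
  rw [ellNorm, if_neg hr', ← ENNReal.rpow_mul, one_div_mul_cancel this.ne', ENNReal.rpow_one,
    tsum_fintype]

end EllNorm

/-! ### Pathwise square functions and maximal functions -/

section Finite

/-- The square function `(∑_{j < n} |d_j|²)^{1/2}` of a sequence of increments. -/
noncomputable def sqPart (d : ℕ → ℝ) (n : ℕ) : ℝ≥0∞ :=
  (∑ j ∈ Finset.range n, ‖d j‖ₑ ^ (2 : ℝ)) ^ (1 / 2 : ℝ)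

/-- The maximal function `max_{m ≤ n} |∑_{j < m} d_j|` of a sequence of increments. -/
noncomputable def maxSum (d : ℕ → ℝ) (n : ℕ) : ℝ≥0∞ :=
  (Finset.range (n + 1)).sup fun m => ‖∑ j ∈ Finset.range m, d j‖ₑ

/-- `max_{j < n} |f_j|`. -/
noncomputable def maxAbs (f : ℕ → ℝ) (n : ℕ) : ℝ≥0∞ :=
  (Finset.range n).sup fun j => ‖f j‖ₑ

theorem sqPart_succ_le (d : ℕ → ℝ) (n : ℕ) : sqPart d (n + 1) ≤ sqPart d n + ‖d n‖ₑ := by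
  rw [sqPart, Finset.sum_range_succ]
  refine (ENNReal.rpow_add_le_add_rpow _ _ (by norm_num) (by norm_num)).trans ?_
  rw [← ENNReal.rpow_mul]
  norm_num [sqPart]

theorem sqPart_zero (d : ℕ → ℝ) : sqPart d 0 = 0 := by simp [sqPart]

theorem sqPart_le_sum (d : ℕ → ℝ) (n : ℕ) : sqPart d n ≤ ∑ j ∈ Finset.range n, ‖d j‖ₑ := by
  induction n with
  | zero => simp [sqPart_zero]
  | succ n ih =>
    rw [Finset.sum_range_succ]
    exact (sqPart_succ_le d n).trans (by gcongr)

theorem sqPart_mono (d : ℕ → ℝ) : Monotone (sqPart d) := by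
  intro m n h
  rw [sqPart, sqPart]
  gcongr

theorem enorm_le_sqPart (d : ℕ → ℝ) {j n : ℕ} (h : j < n) : ‖d j‖ₑ ≤ sqPart d n := by
  calc ‖d j‖ₑ = (‖d j‖ₑ ^ (2 : ℝ)) ^ (1 / 2 : ℝ) := by
        rw [← ENNReal.rpow_mul]; norm_num
    _ ≤ _ := by
        rw [sqPart]
        gcongr
        exact Finset.single_le_sum (f := fun j => ‖d j‖ₑ ^ (2 : ℝ)) (fun _ _ => zero_le)
          (Finset.mem_range.2 h)

theorem sqPart_le_of_le {d e : ℕ → ℝ} {n : ℕ} (h : ∀ j < n, ‖d j‖ₑ ≤ ‖e j‖ₑ) :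
    sqPart d n ≤ sqPart e n := by
  rw [sqPart, sqPart]
  gcongr with j hj
  exact h j (Finset.mem_range.1 hj)

theorem sqPart_add_le (d e : ℕ → ℝ) (n : ℕ) :
    sqPart (fun j => d j + e j) n ≤ sqPart d n + sqPart e n := by
  refine le_trans ?_ (ENNReal.Lp_add_le (Finset.range n) (fun j => ‖d j‖ₑ) (fun j => ‖e j‖ₑ)
    (p := 2) (by norm_num))
  rw [sqPart]
  gcongr
  exact enorm_add_le _ _

theorem sqPart_mul_le (f d : ℕ → ℝ) (n : ℕ) :
    sqPart (fun j => f j * d j) n ≤ maxAbs f n * sqPart d n := by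
  calc sqPart (fun j => f j * d j) n
      ≤ (∑ j ∈ Finset.range n, maxAbs f n ^ (2 : ℝ) * ‖d j‖ₑ ^ (2 : ℝ)) ^ (1 / 2 : ℝ) := by
        rw [sqPart]
        gcongr with j hj
        rw [enorm_mul, ENNReal.mul_rpow_of_nonneg _ _ (by norm_num)]
        gcongr
        exact Finset.le_sup (f := fun j => ‖f j‖ₑ) hj
    _ = _ := by
        rw [← Finset.mul_sum, ENNReal.mul_rpow_of_nonneg _ _ (by norm_num), ← ENNReal.rpow_mul,
          sqPart]
        norm_num

theorem maxSum_le_sum (d : ℕ → ℝ) (n : ℕ) : maxSum d n ≤ ∑ j ∈ Finset.range n, ‖d j‖ₑ := by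
  refine Finset.sup_le fun m hm => ?_
  refine (enorm_sum_le _ _).trans ?_
  gcongr
  simp at hm; omega

theorem enorm_sum_le_maxSum (d : ℕ → ℝ) {m n : ℕ} (h : m ≤ n) :
    ‖∑ j ∈ Finset.range m, d j‖ₑ ≤ maxSum d n :=
  Finset.le_sup (f := fun m => ‖∑ j ∈ Finset.range m, d j‖ₑ) (Finset.mem_range.2 (by omega))

theorem maxSum_mono (d : ℕ → ℝ) : Monotone (maxSum d) := fun _ _ h =>
  Finset.sup_mono (by simpa using h)

theorem maxAbs_mono (f : ℕ → ℝ) : Monotone (maxAbs f) := fun _ _ h =>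
  Finset.sup_mono (by simpa using h)

theorem maxSum_add_le (d e : ℕ → ℝ) (n : ℕ) :
    maxSum (fun j => d j + e j) n ≤ maxSum d n + maxSum e n := by
  refine Finset.sup_le fun m hm => ?_
  rw [Finset.sum_add_distrib]
  refine (enorm_add_le _ _).trans (add_le_add ?_ ?_) <;>
  exact enorm_sum_le_maxSum _ (by simp at hm; omega)

theorem maxSum_ne_top (d : ℕ → ℝ) (n : ℕ) : maxSum d n ≠ ∞ :=
  ne_top_of_le_ne_top (ENNReal.sum_ne_top.2 fun _ _ => enorm_ne_top) (maxSum_le_sum d n)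

theorem sqPart_ne_top (d : ℕ → ℝ) (n : ℕ) : sqPart d n ≠ ∞ :=
  ne_top_of_le_ne_top (ENNReal.sum_ne_top.2 fun _ _ => enorm_ne_top) (sqPart_le_sum d n)

theorem maxAbs_ne_top (f : ℕ → ℝ) (n : ℕ) : maxAbs f n ≠ ∞ := by
  refine ne_top_of_le_ne_top (b := ∑ j ∈ Finset.range n, ‖f j‖ₑ)
    (ENNReal.sum_ne_top.2 fun _ _ => enorm_ne_top) ?_
  exact Finset.sup_le fun j hj =>
    Finset.single_le_sum (f := fun j => ‖f j‖ₑ) (fun _ _ => zero_le) hj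

variable {Ω : Type*} {m : MeasurableSpace Ω}

theorem measurable_sqPart {d : ℕ → Ω → ℝ} {n : ℕ} (h : ∀ j < n, Measurable (d j)) :
    Measurable fun ω => sqPart (fun j => d j ω) n := by
  refine Measurable.pow_const (Finset.measurable_sum _ fun j hj => ?_) _
  exact (h j (Finset.mem_range.1 hj)).enorm.pow_const _

theorem measurable_maxSum {d : ℕ → Ω → ℝ} {n : ℕ} (h : ∀ j < n, Measurable (d j)) :
    Measurable fun ω => maxSum (fun j => d j ω) n := by
  simp only [maxSum, Finset.sup_eq_iSup]
  refine Measurable.iSup fun i => Measurable.iSup fun hi => ?_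
  refine (Finset.measurable_sum _ fun j hj => h j ?_).enorm
  simp at hi hj; omega

theorem measurable_maxAbs {f : ℕ → Ω → ℝ} {n : ℕ} (h : ∀ j < n, Measurable (f j)) :
    Measurable fun ω => maxAbs (fun j => f j ω) n := by
  simp only [maxAbs, Finset.sup_eq_iSup]
  refine Measurable.iSup fun i => Measurable.iSup fun hi => ?_
  exact (h i (Finset.mem_range.1 hi)).enorm

end Finite

/-! ### Martingale differences and the weak type (2,2) inequality -/

/-- A martingale difference sequence: `d j` is the increment from time `j` to time `j + 1`. -/
structure MDS {Ω : Type*} {m : MeasurableSpace Ω} (ℱ : Filtration ℕ m) (P : Measure Ω)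
    (d : ℕ → Ω → ℝ) : Prop where
  meas : ∀ j, Measurable[ℱ (j + 1)] (d j)
  int : ∀ j, Integrable (d j) P
  condExp : ∀ j, P[d j | ℱ j] =ᵐ[P] 0

section MDS

variable {Ω : Type*} {m : MeasurableSpace Ω} {ℱ : Filtration ℕ m} {P : Measure Ω}
  {d : ℕ → Ω → ℝ}

theorem MDS.mul (hd : MDS ℱ P d) {f : ℕ → Ω → ℝ} (hf : ∀ j, Measurable[ℱ j] (f j))
    (hfd : ∀ j, Integrable (fun ω => f j ω * d j ω) P) :
    MDS ℱ P (fun j ω => f j ω * d j ω) where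
  meas j := ((hf j).mono (ℱ.mono (Nat.le_succ j)) le_rfl).mul (hd.meas j)
  int := hfd
  condExp j := by
    have := condExp_mul_of_stronglyMeasurable_left (hf j).stronglyMeasurable (hfd j) (hd.int j)
    refine this.trans ?_
    filter_upwards [hd.condExp j] with ω hω
    simp [hω]

theorem measurable_partialSum {d : ℕ → Ω → ℝ} (hd : ∀ j, Measurable[ℱ (j + 1)] (d j)) (n : ℕ) :
    Measurable[ℱ n] fun ω => ∑ j ∈ Finset.range n, d j ω := by
  refine @Finset.measurable_sum _ _ _ _ _ _ (ℱ n) _ _ fun j hj => ?_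
  exact (hd j).mono (ℱ.mono (by simp at hj; omega)) le_rfl

/-- Orthogonality of increments: the sum over `j < n` is `ℱ n`-measurable and `d n` has conditional
mean zero, so the cross terms vanish. Boundedness of the increments provides all integrability. -/
theorem MDS.lintegral_sq [IsProbabilityMeasure P] (hd : MDS ℱ P d) {B : ℝ}
    (hB : ∀ j, ∀ᵐ ω ∂P, |d j ω| ≤ B) (n : ℕ) :
    ∫⁻ ω, ‖∑ j ∈ Finset.range n, d j ω‖ₑ ^ (2 : ℝ) ∂P
      = ∫⁻ ω, ∑ j ∈ Finset.range n, ‖d j ω‖ₑ ^ (2 : ℝ) ∂P := by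
  have hsum : ∀ n, ∀ᵐ ω ∂P, ‖∑ j ∈ Finset.range n, d j ω‖ ≤ n * B := by
    intro n
    filter_upwards [ae_all_iff.2 hB] with ω hω
    refine (norm_sum_le _ _).trans ((Finset.sum_le_sum fun j _ => hω j).trans_eq ?_)
    simp
  have hm : ∀ n, Measurable fun ω => ∑ j ∈ Finset.range n, d j ω := fun n =>
    (measurable_partialSum hd.meas n).mono (ℱ.le n) le_rfl
  have hdm : ∀ n, Measurable (d n) := fun n => (hd.meas n).mono (ℱ.le _) le_rfl
  have hint : ∀ n, Integrable (fun ω => (∑ j ∈ Finset.range n, d j ω) * d n ω) P := fun n =>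
    (hd.int n).bdd_mul (hm n).aestronglyMeasurable (hsum n)
  have hS2 : ∀ n, Integrable (fun ω => (∑ j ∈ Finset.range n, d j ω) ^ 2) P := fun n => by
    refine (MemLp.of_bound (p := 2) (hm n).aestronglyMeasurable _ (hsum n)).integrable_sq
  have hd2 : ∀ n, Integrable (fun ω => (d n ω) ^ 2) P := fun n =>
    (MemLp.of_bound (p := 2) (hdm n).aestronglyMeasurable _ (hB n)).integrable_sq
  have hzero : ∀ n, ∫ ω, (∑ j ∈ Finset.range n, d j ω) * d n ω ∂P = 0 := by
    intro n
    rw [← integral_condExp (ℱ.le n)]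
    refine integral_eq_zero_of_ae ?_
    refine (condExp_mul_of_stronglyMeasurable_left
      (measurable_partialSum hd.meas n).stronglyMeasurable (hint n) (hd.int n)).trans ?_
    filter_upwards [hd.condExp n] with ω hω
    simp [hω]
  have key : ∫ ω, (∑ j ∈ Finset.range n, d j ω) ^ 2 ∂P
      = ∫ ω, ∑ j ∈ Finset.range n, d j ω ^ 2 ∂P := by
    induction n with
    | zero => simp
    | succ n ih =>
      have h1 : (fun ω => (∑ j ∈ Finset.range (n + 1), d j ω) ^ 2) = fun ω =>
          (∑ j ∈ Finset.range n, d j ω) ^ 2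
            + (2 * ((∑ j ∈ Finset.range n, d j ω) * d n ω) + d n ω ^ 2) := by
        funext ω
        rw [Finset.sum_range_succ]
        ring
      simp_rw [h1, Finset.sum_range_succ]
      have h2 : Integrable (fun ω => 2 * ((∑ j ∈ Finset.range n, d j ω) * d n ω) + d n ω ^ 2) P :=
        ((hint n).const_mul 2).add (hd2 n)
      rw [integral_add (hS2 n) h2,
        integral_add ((hint n).const_mul 2) (hd2 n), integral_const_mul, hzero,
        integral_add (integrable_finsetSum _ fun j _ => hd2 j) (hd2 n), ih]
      ring
  have e1 : ∀ x : ℝ, ‖x‖ₑ ^ (2 : ℝ) = ENNReal.ofReal (x ^ 2) := by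
    intro x
    rw [Real.enorm_eq_ofReal_abs, ENNReal.rpow_two, ← ENNReal.ofReal_pow (abs_nonneg x), sq_abs]
  simp_rw [e1, ← ENNReal.ofReal_sum_of_nonneg (fun i _ => sq_nonneg (d i _))]
  rw [← ofReal_integral_eq_lintegral_ofReal (hS2 n) (.of_forall fun _ => sq_nonneg _),
    ← ofReal_integral_eq_lintegral_ofReal (integrable_finsetSum _ fun j _ => hd2 j)
      (.of_forall fun _ => Finset.sum_nonneg fun _ _ => sq_nonneg _), key]

/-- At the first time the running maximum exceeds `l`, the maximum is attained by the partial sum at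
that very time. -/
theorem exists_maxSum_crossing {d : ℕ → ℝ} {n : ℕ} {l : ℝ≥0∞} (h : l < maxSum d n) :
    ∃ k ≤ n, (∀ j < k, maxSum d j ≤ l) ∧ (∀ j, k ≤ j → l < maxSum d j) ∧
      l < ‖∑ j ∈ Finset.range k, d j‖ₑ := by
  classical
  have hex : ∃ k, l < maxSum d k := ⟨n, h⟩
  refine ⟨Nat.find hex, Nat.find_min' hex h, fun j hj => not_lt.1 (Nat.find_min hex hj),
    fun j hj => (Nat.find_spec hex).trans_le (maxSum_mono d hj), ?_⟩
  obtain ⟨k, hk, hlt⟩ := Finset.lt_sup_iff.1 (Nat.find_spec hex)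
  have h1 : l < maxSum d k := hlt.trans_le (enorm_sum_le_maxSum d le_rfl)
  have h2 : k = Nat.find hex :=
    le_antisymm (Nat.lt_succ_iff.1 (Finset.mem_range.1 hk)) (Nat.find_min' hex h1)
  rwa [← h2]

-- Kolmogorov's argument: multiplying by the indicators `f j` stops the martingale at the first
-- crossing of `l`, where the partial sum exceeds `l` in modulus; then Chebyshev and orthogonality
-- apply to the stopped sum.
open Classical in
theorem MDS.weak_type_two [IsProbabilityMeasure P] (hd : MDS ℱ P d) {B : ℝ}
    (hB : ∀ j, ∀ᵐ ω ∂P, |d j ω| ≤ B) (n : ℕ)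
    (l : ℝ≥0) :
    (l : ℝ≥0∞) ^ (2 : ℝ) * P {ω | l < maxSum (fun j => d j ω) n}
      ≤ ∫⁻ ω, sqPart (fun j => d j ω) n ^ (2 : ℝ) ∂P := by
  let f : ℕ → Ω → ℝ := fun j ω => if maxSum (fun i => d i ω) j ≤ l then 1 else 0
  have hmax : ∀ j, Measurable[ℱ j] fun ω => maxSum (fun i => d i ω) j := fun j =>
    @measurable_maxSum _ (ℱ j) _ _ fun i hi => (hd.meas i).mono (ℱ.mono hi) le_rfl
  have hf : ∀ j, Measurable[ℱ j] (f j) := fun j => by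
    have : MeasurableSet[ℱ j] {ω | maxSum (fun i => d i ω) j ≤ (l : ℝ≥0∞)} := hmax j measurableSet_Iic
    exact Measurable.ite this measurable_const measurable_const
  have hf1 : ∀ j ω, |f j ω| ≤ 1 := fun j ω => by simp only [f]; split_ifs <;> simp
  have hfd : ∀ j ω, |f j ω * d j ω| ≤ |d j ω| := fun j ω => by
    rw [abs_mul]; exact mul_le_of_le_one_left (abs_nonneg _) (hf1 j ω)
  have hint : ∀ j, Integrable (fun ω => f j ω * d j ω) P := fun j =>
    (hd.int j).mono (((hf j).mono (ℱ.le _) le_rfl).aestronglyMeasurable.mul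
      (hd.int j).aestronglyMeasurable) (.of_forall fun ω => hfd j ω)
  have hM := hd.mul hf hint
  have hE := hM.lintegral_sq (B := B) (fun j => (hB j).mono fun ω h => (hfd j ω).trans h) n
  have hset : MeasurableSet {ω | (l : ℝ≥0∞) < maxSum (fun j => d j ω) n} :=
    measurableSet_lt measurable_const ((hmax n).mono (ℱ.le _) le_rfl)
  calc (l : ℝ≥0∞) ^ (2 : ℝ) * P {ω | l < maxSum (fun j => d j ω) n}
      = ∫⁻ ω, {ω | (l : ℝ≥0∞) < maxSum (fun j => d j ω) n}.indicator
          (fun _ => (l : ℝ≥0∞) ^ (2 : ℝ)) ω ∂P := (lintegral_indicator_const hset _).symm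
    _ ≤ ∫⁻ ω, ‖∑ j ∈ Finset.range n, f j ω * d j ω‖ₑ ^ (2 : ℝ) ∂P := by
        refine lintegral_mono (Set.indicator_le' (fun ω hω => ?_) fun _ _ => zero_le)
        obtain ⟨k, hkn, h1, h2, h3⟩ := exists_maxSum_crossing hω
        have : ∑ j ∈ Finset.range n, f j ω * d j ω = ∑ j ∈ Finset.range k, d j ω := by
          rw [← Finset.sum_subset (Finset.range_mono hkn)]
          · refine Finset.sum_congr rfl fun j hj => ?_
            simp [f, h1 j (Finset.mem_range.1 hj)]
          · intro j _ hj
            simp [f, not_le.2 (h2 j (by simpa using hj))]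
        rw [this]
        gcongr
    _ ≤ _ := by
        rw [hE]
        refine lintegral_mono fun ω => ?_
        rw [sqPart, ← ENNReal.rpow_mul]
        norm_num only [ENNReal.rpow_one]
        refine Finset.sum_le_sum fun j _ => ENNReal.rpow_le_rpow ?_ (by norm_num)
        rw [Real.enorm_eq_ofReal_abs, Real.enorm_eq_ofReal_abs]
        exact ENNReal.ofReal_le_ofReal (hfd j ω)

end MDS

/-! ### Weak type inequalities and the good-λ method -/

/-- The weak type inequality `λ^r P(‖h^*‖_{ℓ^r} > λ) ≤ C 𝔼 ‖S h‖_{ℓ^r}^r`, uniformly for finite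
families of martingales with bounded increments. -/
def WeakBDG.{u, v} (ι : Type v) (r : ℝ≥0∞) (C : ℝ≥0) : Prop :=
  ∀ (Ω : Type u) [m : MeasurableSpace Ω] (P : Measure Ω) [IsProbabilityMeasure P]
    (ℱ : Filtration ℕ m) (e : ι → ℕ → Ω → ℝ) (B : ℝ), (∀ k, MDS ℱ P (e k)) →
    (∀ k j, ∀ᵐ ω ∂P, |e k j ω| ≤ B) → ∀ (n : ℕ) (l : ℝ≥0),
    (l : ℝ≥0∞) ^ r.toReal * P {ω | l < ellNorm r fun k => maxSum (fun j => e k j ω) n}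
      ≤ C * ∫⁻ ω, (ellNorm r fun k => sqPart (fun j => e k j ω) n) ^ r.toReal ∂P

/-- Starting point of the bootstrap: over a one-point index set every `ℓ^r` norm is the absolute
value. -/
theorem weakBDG_two_unit.{u} : WeakBDG.{u} Unit 2 1 := by
  intro Ω m P _ ℱ e B he hB n l
  have := (he ()).weak_type_two (hB ()) n l
  simpa [ellNorm_unique] using this

section GoodLambda

/-- The hypothesis is integrated against `t^(q-1) dt`. Rescaling the left side costs `3^q`, and the
smallness of `ε` lets half of the integral of `x^q` be absorbed. -/
theorem lintegral_rpow_le_of_good_lambda_real {Ω : Type*} {m : MeasurableSpace Ω} {P : Measure Ω}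
    [IsFiniteMeasure P] {x v : Ω → ℝ} (hx : Measurable x) (hv : Measurable v)
    (hx0 : ∀ ω, 0 ≤ x ω) (hv0 : ∀ ω, 0 ≤ v ω) {K : ℝ} (hxK : ∀ ω, x ω ≤ K) {q δ : ℝ} (hq : 0 < q)
    (hδ : 0 < δ) {ε : ℝ≥0∞} (hε : ε * ENNReal.ofReal (3 ^ q) ≤ 1 / 2)
    (h : ∀ t : ℝ, 0 < t → P {ω | 3 * t < x ω} ≤ P {ω | δ * t < v ω} + ε * P {ω | t < x ω}) :
    ∫⁻ ω, ENNReal.ofReal (x ω ^ q) ∂P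
      ≤ 2 * ENNReal.ofReal ((3 / δ) ^ q) * ∫⁻ ω, ENNReal.ofReal (v ω ^ q) ∂P := by
  have hmeas : ∀ y : Ω → ℝ, Measurable fun t : ℝ =>
      P {ω | t < y ω} * ENNReal.ofReal (t ^ (q - 1)) := fun y => by
    have : Measurable fun t : ℝ => P {ω | t < y ω} :=
      Antitone.measurable fun s t hst => measure_mono fun ω hω => lt_of_le_of_lt hst hω
    exact this.mul (by fun_prop)
  have scale : ∀ (c : ℝ), 0 < c → ∀ y : Ω → ℝ, (∀ ω, 0 ≤ y ω) →
      ∫⁻ ω, ENNReal.ofReal ((y ω / c) ^ q) ∂P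
        = ENNReal.ofReal ((1 / c) ^ q) * ∫⁻ ω, ENNReal.ofReal (y ω ^ q) ∂P := by
    intro c hc y hy
    rw [← lintegral_const_mul' _ _ ENNReal.ofReal_ne_top]
    refine lintegral_congr fun ω => ?_
    rw [← ENNReal.ofReal_mul (by positivity), ← Real.mul_rpow (by positivity) (hy ω)]
    congr 2
    ring
  -- The bound `K` enters only here, to make the absorption legitimate; it does not appear in the
  -- constant.
  have hI : ∫⁻ ω, ENNReal.ofReal (x ω ^ q) ∂P ≠ ∞ := by
    refine ne_top_of_le_ne_top (b := ∫⁻ _, ENNReal.ofReal (K ^ q) ∂P) ?_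
      (lintegral_mono fun ω => ENNReal.ofReal_le_ofReal
        (Real.rpow_le_rpow (hx0 ω) (hxK ω) hq.le))
    rw [lintegral_const]
    finiteness
  have main : ∫⁻ ω, ENNReal.ofReal ((x ω / 3) ^ q) ∂P
      ≤ ∫⁻ ω, ENNReal.ofReal ((v ω / δ) ^ q) ∂P + ε * ∫⁻ ω, ENNReal.ofReal (x ω ^ q) ∂P := by
    rw [lintegral_rpow_eq_lintegral_meas_lt_mul P
        (.of_forall fun ω => div_nonneg (hx0 ω) (by norm_num)) (hx.div_const 3).aemeasurable hq,
      lintegral_rpow_eq_lintegral_meas_lt_mul P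
        (.of_forall fun ω => div_nonneg (hv0 ω) hδ.le) (hv.div_const δ).aemeasurable hq,
      lintegral_rpow_eq_lintegral_meas_lt_mul P (.of_forall hx0) hx.aemeasurable hq,
      mul_left_comm ε, ← mul_add, ← lintegral_const_mul ε (hmeas x),
      ← lintegral_add_left (hmeas fun ω => v ω / δ)]
    gcongr _ * ?_
    refine setLIntegral_mono' measurableSet_Ioi fun t ht => ?_
    rw [← mul_assoc, ← add_mul]
    gcongr
    refine le_trans (le_of_eq ?_) ((h t ht).trans_eq ?_)
    · congr 1
      ext ω
      simp [lt_div_iff₀, mul_comm]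
    · congr 2
      ext ω
      simp [lt_div_iff₀ hδ, mul_comm]
  set I := ∫⁻ ω, ENNReal.ofReal (x ω ^ q) ∂P
  set J := ∫⁻ ω, ENNReal.ofReal (v ω ^ q) ∂P
  rw [scale 3 (by norm_num) x hx0, scale δ hδ v hv0] at main
  have h3 : ENNReal.ofReal (3 ^ q) * ENNReal.ofReal ((1 / 3) ^ q) = 1 := by
    rw [← ENNReal.ofReal_mul (by positivity), ← Real.mul_rpow (by norm_num) (by norm_num)]
    norm_num
  have h4 : ENNReal.ofReal (3 ^ q) * ENNReal.ofReal ((1 / δ) ^ q) = ENNReal.ofReal ((3 / δ) ^ q) := by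
    rw [← ENNReal.ofReal_mul (by positivity), ← Real.mul_rpow (by norm_num) (by positivity)]
    congr 2
    ring
  have h5 : I ≤ ENNReal.ofReal ((3 / δ) ^ q) * J + I / 2 := by
    calc I = ENNReal.ofReal (3 ^ q) * (ENNReal.ofReal ((1 / 3) ^ q) * I) := by
          rw [← mul_assoc, h3, one_mul]
      _ ≤ ENNReal.ofReal (3 ^ q) * (ENNReal.ofReal ((1 / δ) ^ q) * J + ε * I) := by gcongr
      _ = ENNReal.ofReal ((3 / δ) ^ q) * J + ε * ENNReal.ofReal (3 ^ q) * I := by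
          rw [mul_add, ← mul_assoc, h4]; ring
      _ ≤ ENNReal.ofReal ((3 / δ) ^ q) * J + 1 / 2 * I := by gcongr
      _ = _ := by rw [one_div, mul_comm _ I, ENNReal.div_eq_inv_mul, mul_comm I]
  have h6 : I / 2 ≤ ENNReal.ofReal ((3 / δ) ^ q) * J := by
    have : I / 2 ≠ ∞ := ENNReal.div_ne_top hI (by norm_num)
    rw [← ENNReal.add_le_add_iff_right this, ENNReal.add_halves]
    exact h5
  calc I = 2 * (I / 2) := by rw [ENNReal.mul_div_cancel (by norm_num) (by norm_num)]
    _ ≤ 2 * (ENNReal.ofReal ((3 / δ) ^ q) * J) := by gcongr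
    _ = _ := by ring

theorem lintegral_rpow_le_of_good_lambda {Ω : Type*} {m : MeasurableSpace Ω} {P : Measure Ω}
    [IsFiniteMeasure P] {X V : Ω → ℝ≥0∞} (hX : Measurable X) (hV : Measurable V)
    (hX' : ∀ ω, X ω ≠ ∞) (hV' : ∀ ω, V ω ≠ ∞) {q δ : ℝ} (hq : 0 < q)
    (hδ : 0 < δ) {ε : ℝ≥0∞} (hε : ε * ENNReal.ofReal (3 ^ q) ≤ 1 / 2)
    (h : ∀ t : ℝ, 0 < t → P {ω | ENNReal.ofReal (3 * t) < X ω}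
      ≤ P {ω | ENNReal.ofReal (δ * t) < V ω} + ε * P {ω | ENNReal.ofReal t < X ω}) :
    ∫⁻ ω, X ω ^ q ∂P ≤ 2 * ENNReal.ofReal ((3 / δ) ^ q) * ∫⁻ ω, V ω ^ q ∂P := by
  have conv : ∀ Y : Ω → ℝ≥0∞, (∀ ω, Y ω ≠ ∞) → ∀ ω,
      Y ω ^ q = ENNReal.ofReal ((Y ω).toReal ^ q) := by
    intro Y hY ω
    rw [← ENNReal.ofReal_rpow_of_nonneg ENNReal.toReal_nonneg hq.le, ENNReal.ofReal_toReal (hY ω)]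
  have hlt : ∀ Y : Ω → ℝ≥0∞, (∀ ω, Y ω ≠ ∞) → ∀ t : ℝ, 0 < t → ∀ ω,
      (ENNReal.ofReal t < Y ω ↔ t < (Y ω).toReal) := by
    intro Y hY t ht ω
    exact ENNReal.ofReal_lt_iff_lt_toReal ht.le (hY ω)
  have trunc : ∀ K : ℕ, ∫⁻ ω, ENNReal.ofReal ((min (X ω).toReal K) ^ q) ∂P
      ≤ 2 * ENNReal.ofReal ((3 / δ) ^ q) * ∫⁻ ω, V ω ^ q ∂P := by
    intro K
    simp_rw [conv V hV']
    refine lintegral_rpow_le_of_good_lambda_real (hX.ennreal_toReal.min measurable_const)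
      hV.ennreal_toReal (fun ω => le_min ENNReal.toReal_nonneg (by positivity))
      (fun ω => ENNReal.toReal_nonneg) (fun ω => min_le_right _ _) hq hδ hε fun t ht => ?_
    have h1 := h t ht
    simp_rw [hlt X hX' _ ht, hlt X hX' (3 * t) (by positivity), hlt V hV' (δ * t) (by positivity)]
      at h1
    -- Truncation at `K` preserves the hypothesis: for `3t < K` no event changes, and for `3t ≥ K`
    -- the event on the left is empty.
    rcases lt_or_ge (3 * t) (K : ℝ) with hK | hK
    · have htK : t < (K : ℝ) := by linarith
      simpa only [lt_min_iff, hK, htK, and_true] using h1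
    · simp [not_lt.2 hK]
  calc ∫⁻ ω, X ω ^ q ∂P
      ≤ ∫⁻ ω, ⨆ K : ℕ, ENNReal.ofReal ((min (X ω).toReal K) ^ q) ∂P := by
        refine lintegral_mono fun ω => ?_
        obtain ⟨K, hK⟩ := exists_nat_ge (X ω).toReal
        refine le_iSup_of_le K ?_
        rw [min_eq_left hK, conv X hX']
    _ = ⨆ K : ℕ, ∫⁻ ω, ENNReal.ofReal ((min (X ω).toReal K) ^ q) ∂P := by
        refine lintegral_iSup (fun K => ?_) fun K L hKL ω => ?_
        · exact ((hX.ennreal_toReal.min measurable_const).pow_const q).ennreal_ofReal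
        · refine ENNReal.ofReal_le_ofReal (Real.rpow_le_rpow ?_ ?_ hq.le)
          · exact le_min ENNReal.toReal_nonneg (by positivity)
          · exact min_le_min_left _ (by exact_mod_cast hKL)
    _ ≤ _ := iSup_le trunc

variable {ι : Type*} {r : ℝ≥0∞}

/-- Whenever `Z n > c` the next increment is suppressed and the square function does not grow;
otherwise `Z n` bounds the whole square function through that increment. Hence `Z` need not be
monotone. -/
theorem ellNorm_sqPart_truncate_le (hr : 1 ≤ r) {e e' : ι → ℕ → ℝ} {Z : ℕ → ℝ≥0∞} {N : ℕ}
    {c : ℝ≥0∞} (hZ : ∀ n < N, (ellNorm r fun k => sqPart (e k) (n + 1)) ≤ Z n)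
    (h1 : ∀ k, ∀ j < N, ‖e' k j‖ₑ ≤ ‖e k j‖ₑ) (h2 : ∀ k, ∀ j < N, c < Z j → e' k j = 0)
    {n : ℕ} (hn : n ≤ N) : (ellNorm r fun k => sqPart (e' k) n) ≤ c := by
  induction n with
  | zero => simp [sqPart_zero, ellNorm_zero (zero_lt_one.trans_le hr).ne']
  | succ n ih =>
    rcases le_or_gt (Z n) c with hc | hc
    · refine le_trans (ellNorm_mono fun k => sqPart_le_of_le fun j hj => h1 k j (by omega)) ?_
      exact (hZ n hn).trans hc
    · refine le_trans (ellNorm_mono fun k => ?_) (ih (by omega))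
      simpa [h2 k n hn hc] using sqPart_succ_le (e' k) n

/-- Reaching `3l` splits into three pieces: at most `l` before the first crossing of `l`, at most
`l` from the crossing increment (by the square function bound), and the remainder, which is `e'`. -/
theorem lt_ellNorm_maxSum_restart (hr : 1 ≤ r) {e e' : ι → ℕ → ℝ} {N : ℕ} {l : ℝ≥0}
    (hZ : ∀ n < N, (ellNorm r fun k => sqPart (e k) (n + 1)) ≤ l)
    (h1 : ∀ k, ∀ j < N, l < (ellNorm r fun k => maxSum (e k) j) → e' k j = e k j)
    (h2 : ∀ k, ∀ j < N, ¬ l < (ellNorm r fun k => maxSum (e k) j) → e' k j = 0)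
    (h : 3 * l < ellNorm r fun k => maxSum (e k) N) :
    l < ellNorm r fun k => maxSum (e' k) N := by
  classical
  have hr0 : r ≠ 0 := (zero_lt_one.trans_le hr).ne'
  set X : ℕ → ℝ≥0∞ := fun j => ellNorm r fun k => maxSum (e k) j with hX
  have hXmono : Monotone X := fun a b hab => ellNorm_mono fun k => maxSum_mono _ hab
  have hlN : (l : ℝ≥0∞) < X N := by
    refine lt_of_le_of_lt ?_ h
    calc (l : ℝ≥0∞) = 1 * l := (one_mul _).symm
      _ ≤ 3 * l := by gcongr; norm_num
  have hex : ∃ n, (l : ℝ≥0∞) < X n := ⟨N, hlN⟩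
  obtain ⟨n, hn⟩ : ∃ n, Nat.find hex = n + 1 := by
    refine Nat.exists_eq_succ_of_ne_zero fun h0 => ?_
    have := Nat.find_spec hex
    rw [h0] at this
    simp [X, maxSum, ellNorm_zero hr0] at this
  have hnN : n < N := by
    have := Nat.find_min' hex hlN
    omega
  have hlow : ∀ j ≤ n, ¬ (l : ℝ≥0∞) < X j := fun j hj => Nat.find_min hex (by omega)
  have hhigh : ∀ j, n < j → (l : ℝ≥0∞) < X j := fun j hj =>
    (Nat.find_spec hex).trans_le (hXmono (by omega))
  have hk : ∀ k, maxSum (e k) N ≤ (maxSum (e k) n + ‖e k n‖ₑ) + maxSum (e' k) N := by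
    intro k
    refine Finset.sup_le fun M hM => ?_
    have hMN : M ≤ N := by simp at hM; omega
    rcases le_or_gt M n with hMn | hMn
    · exact (enorm_sum_le_maxSum _ hMn).trans (le_self_add.trans le_self_add)
    · have e1 : ∑ j ∈ Finset.range M, e k j
          = (∑ j ∈ Finset.range n, e k j + e k n) + ∑ j ∈ Finset.range M, e' k j := by
        rw [← Finset.sum_range_succ, ← Finset.sum_range_add_sum_Ico (e k) (show n + 1 ≤ M from hMn),
          ← Finset.sum_range_add_sum_Ico (e' k) (show n + 1 ≤ M from hMn)]
        congr 1
        rw [Finset.sum_eq_zero (s := Finset.range (n + 1)), zero_add]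
        · refine Finset.sum_congr rfl fun j hj => (h1 k j ?_ (hhigh j ?_)).symm <;>
          simp at hj <;> omega
        · intro j hj
          refine h2 k j ?_ (hlow j ?_) <;> simp at hj <;> omega
      rw [e1]
      refine (enorm_add_le _ _).trans (add_le_add ((enorm_add_le _ _).trans ?_) ?_)
      · gcongr
        exact enorm_sum_le_maxSum _ le_rfl
      · exact enorm_sum_le_maxSum _ hMN
  have hfin : X N ≤ (l + l) + ellNorm r fun k => maxSum (e' k) N := by
    refine (ellNorm_mono hk).trans ((ellNorm_add_le hr _ _).trans ?_)
    gcongr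
    refine (ellNorm_add_le hr _ _).trans (add_le_add (not_lt.1 (hlow n le_rfl)) ?_)
    exact (ellNorm_mono fun k => enorm_le_sqPart _ (Nat.lt_succ_self n)).trans (hZ n hnN)
  by_contra hcon
  have := hfin.trans (add_le_add_right (not_lt.1 hcon) _)
  refine absurd h (not_lt.2 (this.trans_eq ?_))
  ring

end GoodLambda

/-! ### From weak type to `L^q` under predictable control of the square function -/

section GoodLambdaMaximal

-- `Z j` is known at time `j` but controls the square function through increment `j`. So the
-- transform can be started after the maximal function passes `l` and switched off before its square
-- function exceeds `δ l`; the weak type inequality then gains the factor `δ^r`.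
open Classical in
theorem measure_maxSum_good_lambda.{u, v} {r : ℝ≥0∞} (hr : 1 ≤ r) (hr' : r ≠ ∞) {C : ℝ≥0}
    {ι : Type v} [Fintype ι] (hC : WeakBDG.{u, v} ι r C)
    {Ω : Type u} {m : MeasurableSpace Ω} {P : Measure Ω} [IsProbabilityMeasure P]
    {ℱ : Filtration ℕ m} {p f : ι → ℕ → Ω → ℝ} (hp : ∀ k, MDS ℱ P (p k))
    (hf : ∀ k j, Measurable[ℱ j] (f k j)) (N : ℕ) {Z : ℕ → Ω → ℝ≥0∞} {V : Ω → ℝ≥0∞}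
    (hZ : ∀ j, Measurable[ℱ j] (Z j)) (hZV : ∀ j < N, ∀ ω, Z j ω ≤ V ω)
    (hSZ : ∀ n < N, ∀ᵐ ω ∂P,
      (ellNorm r fun k => sqPart (fun j => f k j ω * p k j ω) (n + 1)) ≤ Z n ω)
    {δ l : ℝ≥0} (hδ : δ ≤ 1) (hl : 0 < l) :
    P {ω | ((3 * l : ℝ≥0) : ℝ≥0∞) < ellNorm r fun k => maxSum (fun j => f k j ω * p k j ω) N}
      ≤ P {ω | ((δ * l : ℝ≥0) : ℝ≥0∞) < V ω} + (C * (δ : ℝ≥0∞) ^ r.toReal) *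
        P {ω | (l : ℝ≥0∞) < ellNorm r fun k => maxSum (fun j => f k j ω * p k j ω) N} := by
  have hr0 : r ≠ 0 := (zero_lt_one.trans_le hr).ne'
  have hr1 : 0 < r.toReal := ENNReal.toReal_pos hr0 hr'
  set X : ℕ → Ω → ℝ≥0∞ := fun n ω => ellNorm r fun k => maxSum (fun j => f k j ω * p k j ω) n
  have hXmono : ∀ ω, Monotone fun n => X n ω := fun ω a b hab =>
    ellNorm_mono fun k => maxSum_mono _ hab
  have hXm : ∀ n, Measurable[ℱ n] (X n) := fun n =>
    @measurable_ellNorm ι _ Ω (ℱ n) r _ fun k => @measurable_maxSum Ω (ℱ n) _ _ fun j hj =>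
      ((hf k j).mono (ℱ.mono hj.le) le_rfl).mul (((hp k).meas j).mono (ℱ.mono hj) le_rfl)
  let f' : ι → ℕ → Ω → ℝ := fun k j ω =>
    if j < N ∧ l < X j ω ∧ Z j ω ≤ ((δ * l : ℝ≥0) : ℝ≥0∞) then f k j ω else 0
  have hf' : ∀ k j, Measurable[ℱ j] (f' k j) := fun k j => by
    have h1 : MeasurableSet[ℱ j] {ω | (l : ℝ≥0∞) < X j ω} := hXm j measurableSet_Ioi
    have h2 : MeasurableSet[ℱ j] {ω | Z j ω ≤ ((δ * l : ℝ≥0) : ℝ≥0∞)} := hZ j measurableSet_Iic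
    exact Measurable.ite ((@MeasurableSet.const _ (ℱ j) (j < N)).inter (h1.inter h2)) (hf k j)
      measurable_const
  have hle : ∀ k j ω, ‖f' k j ω * p k j ω‖ₑ ≤ ‖f k j ω * p k j ω‖ₑ := fun k j ω => by
    simp only [f']
    split_ifs <;> simp
  have hZ0 : ∀ k, ∀ j < N, ∀ ω, ((δ * l : ℝ≥0) : ℝ≥0∞) < Z j ω → f' k j ω * p k j ω = 0 :=
    fun k j _ ω h => by
      simp only [f', if_neg fun hc : _ ∧ _ ∧ _ => not_le.2 h hc.2.2, zero_mul]
  have hSZ' : ∀ᵐ ω ∂P, ∀ n < N,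
      (ellNorm r fun k => sqPart (fun j => f k j ω * p k j ω) (n + 1)) ≤ Z n ω := by
    rw [ae_all_iff]
    intro n
    by_cases hn : n < N
    · simpa [hn] using hSZ n hn
    · simp [hn]
  -- The weak type inequality requires bounded increments; the truncation produces this bound, which
  -- also gives integrability of the transform.
  have hbound : ∀ k j, ∀ᵐ ω ∂P, |f' k j ω * p k j ω| ≤ (δ * l : ℝ≥0) := by
    intro k j
    filter_upwards [hSZ'] with ω hω
    by_cases hc : j < N ∧ l < X j ω ∧ Z j ω ≤ ((δ * l : ℝ≥0) : ℝ≥0∞)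
    · have h1 : ‖f k j ω * p k j ω‖ₑ ≤ ((δ * l : ℝ≥0) : ℝ≥0∞) :=
        calc ‖f k j ω * p k j ω‖ₑ ≤ sqPart (fun j => f k j ω * p k j ω) (j + 1) :=
              enorm_le_sqPart (fun j => f k j ω * p k j ω) (Nat.lt_succ_self j)
          _ ≤ _ := le_ellNorm hr0 (fun k => sqPart (fun j => f k j ω * p k j ω) (j + 1)) k
          _ ≤ _ := (hω j hc.1).trans hc.2.2
      simp only [f', if_pos hc]
      rw [← Real.norm_eq_abs]
      rwa [enorm_le_coe, ← NNReal.coe_le_coe, coe_nnnorm] at h1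
    · simp only [f', if_neg hc, zero_mul, abs_zero]
      positivity
  have hMDS : ∀ k, MDS ℱ P fun j ω => f' k j ω * p k j ω := fun k => by
    refine (hp k).mul (hf' k) fun j => ?_
    refine Integrable.of_bound ?_ _ (hbound k j)
    exact ((hf' k j).mono (ℱ.le _) le_rfl).aestronglyMeasurable.mul
      ((hp k).int j).aestronglyMeasurable
  have hweak := hC Ω P ℱ (fun k j ω => f' k j ω * p k j ω) _ hMDS hbound N l
  have hset : MeasurableSet {ω | (l : ℝ≥0∞) < X N ω} :=
    (hXm N).mono (ℱ.le _) le_rfl measurableSet_Ioi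
  have hS : ∫⁻ ω, (ellNorm r fun k => sqPart (fun j => f' k j ω * p k j ω) N) ^ r.toReal ∂P
      ≤ ((δ * l : ℝ≥0) : ℝ≥0∞) ^ r.toReal * P {ω | (l : ℝ≥0∞) < X N ω} := by
    rw [← lintegral_indicator_const hset]
    refine lintegral_mono_ae ?_
    filter_upwards [hSZ'] with ω hω
    by_cases hc : (l : ℝ≥0∞) < X N ω
    · rw [Set.indicator_of_mem (by exact hc)]
      gcongr
      exact ellNorm_sqPart_truncate_le hr (e := fun k j => f k j ω * p k j ω)
        (Z := fun n => Z n ω) hω (fun k j _ => hle k j ω) (fun k j hj => hZ0 k j hj ω) le_rfl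
    -- If the level `l` is never passed, the transform never starts; this localizes the square
    -- function to the event `l < X N`.
    · have : ∀ k, sqPart (fun j => f' k j ω * p k j ω) N ≤ 0 := fun k => by
        refine (sqPart_le_sum _ _).trans_eq (Finset.sum_eq_zero fun j hj => ?_)
        have : ¬ (l : ℝ≥0∞) < X j ω := fun h =>
          hc (h.trans_le (hXmono ω (Finset.mem_range.1 hj).le))
        simp [f', this]
      have h0 := (ellNorm_mono (r := r) this).trans_eq (ellNorm_zero hr0)
      rw [nonpos_iff_eq_zero.1 h0, ENNReal.zero_rpow_of_pos hr1]
      exact zero_le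
  have hweak' : P {ω | (l : ℝ≥0∞) < ellNorm r fun k => maxSum (fun j => f' k j ω * p k j ω) N}
      ≤ (C * (δ : ℝ≥0∞) ^ r.toReal) * P {ω | (l : ℝ≥0∞) < X N ω} := by
    have hl0 : (l : ℝ≥0∞) ^ r.toReal ≠ 0 := by
      simp [hl.ne']
    have hl1 : (l : ℝ≥0∞) ^ r.toReal ≠ ∞ := by finiteness
    rw [← ENNReal.mul_le_mul_iff_right hl0 hl1]
    refine hweak.trans ((mul_le_mul_right hS _).trans_eq ?_)
    rw [ENNReal.coe_mul, ENNReal.mul_rpow_of_nonneg _ _ hr1.le]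
    ring
  refine le_trans ?_ (add_le_add_right hweak' _)
  refine le_trans (measure_mono_ae ?_) (measure_union_le _ _)
  filter_upwards [hSZ'] with ω hω h3
  by_cases hV : ((δ * l : ℝ≥0) : ℝ≥0∞) < V ω
  · exact Or.inl hV
  · refine Or.inr ?_
    have hZl : ∀ j < N, Z j ω ≤ ((δ * l : ℝ≥0) : ℝ≥0∞) := fun j hj =>
      (hZV j hj ω).trans (not_lt.1 hV)
    refine lt_ellNorm_maxSum_restart hr (e := fun k j => f k j ω * p k j ω) ?_ ?_ ?_ ?_
    · intro n hn
      refine (hω n hn).trans ((hZl n hn).trans ?_)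
      exact_mod_cast mul_le_of_le_one_left zero_le hδ
    · intro k j hj h
      have : l < X j ω := h
      simp only [f', if_pos (And.intro hj (And.intro this (hZl j hj)))]
    · intro k j hj h
      have : ¬ l < X j ω := h
      simp [f', this]
    · have : ((3 * l : ℝ≥0) : ℝ≥0∞) < X N ω := h3
      simpa using this

theorem eLpNorm_maxSum_le_of_weakBDG.{u, v} {r q : ℝ≥0∞} (hr : 1 ≤ r) (hr' : r ≠ ∞) (hq : q ≠ 0)
    (hq' : q ≠ ∞) (C : ℝ≥0) :
    ∃ C' : ℝ≥0, ∀ (ι : Type v) [Fintype ι], WeakBDG.{u, v} ι r C →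
    ∀ (Ω : Type u) [m : MeasurableSpace Ω] (P : Measure Ω) [IsProbabilityMeasure P]
    (ℱ : Filtration ℕ m) (p f : ι → ℕ → Ω → ℝ), (∀ k, MDS ℱ P (p k)) →
    (∀ k j, Measurable[ℱ j] (f k j)) → ∀ (N : ℕ) (Z : ℕ → Ω → ℝ≥0∞) (V : Ω → ℝ≥0∞),
    (∀ j, Measurable[ℱ j] (Z j)) → Measurable V → (∀ ω, V ω ≠ ∞) →
    (∀ j < N, ∀ ω, Z j ω ≤ V ω) →
    (∀ n < N, ∀ᵐ ω ∂P,
      (ellNorm r fun k => sqPart (fun j => f k j ω * p k j ω) (n + 1)) ≤ Z n ω) →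
    eLpNorm (fun ω => ellNorm r fun k => maxSum (fun j => f k j ω * p k j ω) N) q P
      ≤ C' * eLpNorm V q P := by
  have hr0 : r ≠ 0 := (zero_lt_one.trans_le hr).ne'
  have hr1 : 1 ≤ r.toReal := by simpa using ENNReal.toReal_mono hr' hr
  have hq0 : 0 < q.toReal := ENNReal.toReal_pos hq hq'
  -- With `δ = 1 / A ≤ 1` and `r ≥ 1`, `C δ^r 3^q ≤ (C + 1) δ 3^q = 1/2`, as the good-λ lemma
  -- demands.
  let A : ℝ≥0 := 2 * 3 ^ q.toReal * (C + 1)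
  have hA0 : 1 ≤ A := by
    have h1 : (1 : ℝ≥0) ≤ 3 ^ q.toReal := NNReal.one_le_rpow (by norm_num) hq0.le
    calc (1 : ℝ≥0) = 1 * 1 * 1 := by norm_num
      _ ≤ 2 * 3 ^ q.toReal * (C + 1) := by
        gcongr
        · norm_num
        · exact le_add_self
  have hApos : 0 < A := zero_lt_one.trans_le hA0
  let δ : ℝ≥0 := A⁻¹
  have hδ0 : 0 < δ := inv_pos.2 hApos
  have hδ1 : δ ≤ 1 := inv_le_one_of_one_le₀ hA0
  have hε : (C * (δ : ℝ≥0∞) ^ r.toReal) * ENNReal.ofReal (3 ^ q.toReal) ≤ 1 / 2 := by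
    have h1 : C * δ ^ r.toReal * 3 ^ q.toReal ≤ 1 / 2 := by
      have h2 : δ ^ r.toReal ≤ δ := by
        simpa using NNReal.rpow_le_rpow_of_exponent_ge hδ0 hδ1 hr1
      calc C * δ ^ r.toReal * 3 ^ q.toReal ≤ (C + 1) * δ * 3 ^ q.toReal := by
            gcongr
            exact le_self_add
        _ = 1 / 2 := by
            have : (C + 1) * 3 ^ q.toReal ≠ 0 := by positivity
            simp only [δ, A]
            field_simp
    have h3 : ENNReal.ofReal (3 ^ q.toReal) = ((3 ^ q.toReal : ℝ≥0) : ℝ≥0∞) := by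
      rw [ENNReal.ofReal, Real.toNNReal_rpow_of_nonneg (by norm_num)]
      norm_num
    rw [h3, ← ENNReal.coe_rpow_of_nonneg _ (by positivity)]
    have : (1 / 2 : ℝ≥0∞) = ((1 / 2 : ℝ≥0) : ℝ≥0∞) := by simp
    rw [this]
    exact_mod_cast h1
  let B : ℝ≥0∞ := 2 * ENNReal.ofReal ((3 / δ) ^ q.toReal)
  have hB : B ^ (1 / q.toReal) ≠ ∞ :=
    ENNReal.rpow_ne_top_of_nonneg (by positivity) (ENNReal.mul_ne_top (by norm_num) (by simp))
  refine ⟨(B ^ (1 / q.toReal)).toNNReal, ?_⟩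
  intro ι _ hC Ω m P _ ℱ p f hp hf N Z V hZ hV hV' hZV hSZ
  rw [ENNReal.coe_toNNReal hB, eLpNorm_ennreal_eq hq hq', eLpNorm_ennreal_eq hq hq',
    ← ENNReal.mul_rpow_of_nonneg _ _ (by positivity)]
  gcongr
  refine lintegral_rpow_le_of_good_lambda ?_ hV ?_ hV' hq0 (δ := δ) (by exact_mod_cast hδ0) hε ?_
  · exact measurable_ellNorm fun k => measurable_maxSum fun j _ =>
      ((hf k j).mono (ℱ.le _) le_rfl).mul (((hp k).meas j).mono (ℱ.le _) le_rfl)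
  · exact fun ω => ellNorm_ne_top fun k => maxSum_ne_top _ _
  · intro t ht
    lift t to ℝ≥0 using ht.le
    have := measure_maxSum_good_lambda hr hr' hC hp hf N hZ hZV hSZ hδ1 (l := t)
      (by exact_mod_cast ht)
    have e : ∀ x : ℝ≥0, ENNReal.ofReal (x : ℝ) = x := fun x => ENNReal.ofReal_coe_nnreal
    rw [← e, ← e, ← e] at this
    simpa using this

end GoodLambdaMaximal

/-! ### Conditional expectations: dual Doob and conditional Jensen -/

section CondExp

/-- The measures with densities `w` and `P[w | m']` agree on `m'`, and an `m'`-measurable `W` sees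
only these restrictions; no integrability of the product is needed. -/
theorem lintegral_mul_ofReal_condExp {Ω : Type*} {m' m : MeasurableSpace Ω} {P : Measure Ω}
    [IsFiniteMeasure P] (hm : m' ≤ m) {w : Ω → ℝ} (hw : Integrable w P) (hw0 : 0 ≤ᵐ[P] w)
    {W : Ω → ℝ≥0∞} (hW : Measurable[m'] W) :
    ∫⁻ ω, ENNReal.ofReal (P[w | m'] ω) * W ω ∂P = ∫⁻ ω, ENNReal.ofReal (w ω) * W ω ∂P := by
  have hc0 : 0 ≤ᵐ[P] P[w | m'] := condExp_nonneg hw0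
  have hWm : Measurable W := hW.mono hm le_rfl
  have hcm : AEMeasurable (fun ω => ENNReal.ofReal (P[w | m'] ω)) P :=
    integrable_condExp.aestronglyMeasurable.aemeasurable.ennreal_ofReal
  have hwm : AEMeasurable (fun ω => ENNReal.ofReal (w ω)) P :=
    hw.aestronglyMeasurable.aemeasurable.ennreal_ofReal
  have key : (P.withDensity fun ω => ENNReal.ofReal (P[w | m'] ω)).trim hm
      = (P.withDensity fun ω => ENNReal.ofReal (w ω)).trim hm := by
    refine @Measure.ext _ m' _ _ fun s hs => ?_
    rw [trim_measurableSet_eq hm hs, trim_measurableSet_eq hm hs, withDensity_apply _ (hm s hs),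
      withDensity_apply _ (hm s hs),
      ← ofReal_integral_eq_lintegral_ofReal integrable_condExp.integrableOn
        (ae_restrict_of_ae hc0),
      ← ofReal_integral_eq_lintegral_ofReal hw.integrableOn (ae_restrict_of_ae hw0),
      setIntegral_condExp hm hw hs]
  have h1 := lintegral_withDensity_eq_lintegral_mul₀ hcm hWm.aemeasurable
  have h2 := lintegral_withDensity_eq_lintegral_mul₀ hwm hWm.aemeasurable
  simp only [Pi.mul_apply] at h1 h2
  rw [← h1, ← h2, ← lintegral_trim hm hW, ← lintegral_trim hm hW, key]

theorem rpow_add_le_add_mul_rpow {q : ℝ} (hq : 1 ≤ q) {a c : ℝ≥0∞} (ha : a ≠ ∞) (hc : c ≠ ∞) :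
    (a + c) ^ q ≤ a ^ q + ENNReal.ofReal q * (c * (a + c) ^ (q - 1)) := by
  lift a to ℝ≥0 using ha
  lift c to ℝ≥0 using hc
  rcases eq_or_ne (a + c) 0 with h0 | h0
  · have : (a : ℝ≥0∞) + c = 0 := by exact_mod_cast h0
    rw [this, ENNReal.zero_rpow_of_pos (by linarith)]
    exact zero_le
  have hb : 0 < (a : ℝ) + c := by
    have : 0 < a + c := pos_iff_ne_zero.2 h0
    exact_mod_cast this
  -- Bernoulli's inequality for `(a / (a + c))^q`, to be multiplied by `(a + c)^q`.
  have h1 := one_add_mul_self_le_rpow_one_add (s := -(c / (a + c) : ℝ)) (by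
    rw [neg_le_neg_iff, div_le_one hb]
    have := a.coe_nonneg
    simp) hq
  have h2 : (1 : ℝ) + -(c / (a + c)) = a / (a + c) := by
    field_simp
    ring
  rw [h2, Real.div_rpow a.coe_nonneg hb.le] at h1
  have hbq : 0 < ((a : ℝ) + c) ^ q := Real.rpow_pos_of_pos hb q
  have h3 : ((a : ℝ) + c) ^ q ≤ (a : ℝ) ^ q + q * (c * ((a : ℝ) + c) ^ (q - 1)) := by
    rw [le_div_iff₀ hbq] at h1
    rw [Real.rpow_sub_one hb.ne']
    have : (1 + q * -((c : ℝ) / (a + c))) * ((a : ℝ) + c) ^ q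
        = ((a : ℝ) + c) ^ q - q * (c * (((a : ℝ) + c) ^ q / (a + c))) := by
      field_simp
      ring
    linarith
  have e1 : ((a : ℝ≥0∞) + c) ^ q = ENNReal.ofReal (((a : ℝ) + c) ^ q) := by
    rw [← ENNReal.ofReal_rpow_of_pos hb, ENNReal.ofReal_add a.coe_nonneg c.coe_nonneg]
    simp
  have e2 : ((a : ℝ≥0∞) + c) ^ (q - 1) = ENNReal.ofReal (((a : ℝ) + c) ^ (q - 1)) := by
    rw [← ENNReal.ofReal_rpow_of_pos hb, ENNReal.ofReal_add a.coe_nonneg c.coe_nonneg]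
    simp
  have e3 : (a : ℝ≥0∞) ^ q = ENNReal.ofReal ((a : ℝ) ^ q) := by
    rw [← ENNReal.ofReal_rpow_of_nonneg a.coe_nonneg (by linarith)]
    simp
  have e4 : (c : ℝ≥0∞) = ENNReal.ofReal c := by simp
  rw [e1, e2, e3, e4, ← ENNReal.ofReal_mul c.coe_nonneg, ← ENNReal.ofReal_mul (by linarith),
    ← ENNReal.ofReal_add (by positivity) (by positivity)]
  exact ENNReal.ofReal_le_ofReal h3

theorem rpow_sum_le {q : ℝ} (hq : 1 ≤ q) {c : ℕ → ℝ≥0∞} (hc : ∀ j, c j ≠ ∞) (N : ℕ) :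
    (∑ j ∈ Finset.range N, c j) ^ q
      ≤ ENNReal.ofReal q * ∑ n ∈ Finset.range N,
          c n * (∑ j ∈ Finset.range (n + 1), c j) ^ (q - 1) := by
  induction N with
  | zero => simp [ENNReal.zero_rpow_of_pos (zero_lt_one.trans_le hq)]
  | succ N ih =>
    rw [Finset.sum_range_succ _ N]
    refine (rpow_add_le_add_mul_rpow hq (ENNReal.sum_ne_top.2 fun j _ => hc j) (hc N)).trans ?_
    rw [Finset.sum_range_succ (fun n => c n * (∑ j ∈ Finset.range (n + 1), c j) ^ (q - 1)), mul_add]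
    refine add_le_add ih ?_
    rw [Finset.sum_range_succ c N]

theorem eLpNorm_ennreal_sum_le {Ω : Type*} {m : MeasurableSpace Ω} {P : Measure Ω} {q : ℝ≥0∞}
    (hq : 1 ≤ q) {κ : Type*} (s : Finset κ) {c : κ → Ω → ℝ≥0∞} (hc : ∀ j, AEMeasurable (c j) P) :
    eLpNorm (fun ω => ∑ j ∈ s, c j ω) q P ≤ ∑ j ∈ s, eLpNorm (c j) q P := by
  classical
  induction s using Finset.induction_on with
  | empty => simp
  | insert i s hi ih =>
    simp only [Finset.sum_insert hi]
    exact (eLpNorm_ennreal_add_le hq (hc i) (Finset.aemeasurable_fun_sum _ fun j _ => hc j)).trans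
      (by gcongr)

/-- The dual form of Doob's inequality: `‖∑_j 𝔼_j w_j‖_q ≤ q ‖∑_j w_j‖_q` for nonnegative `w_j`. -/
theorem eLpNorm_sum_condExp_le {Ω : Type*} {m : MeasurableSpace Ω} {P : Measure Ω}
    [IsProbabilityMeasure P] (ℱ : Filtration ℕ m) {w : ℕ → Ω → ℝ} (hw : ∀ j, Integrable (w j) P)
    (hw0 : ∀ j ω, 0 ≤ w j ω) {q : ℝ≥0∞} (hq : 1 ≤ q) (hq' : q ≠ ∞) (N : ℕ) :
    eLpNorm (fun ω => ∑ j ∈ Finset.range N, ENNReal.ofReal (P[w j | ℱ j] ω)) q P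
      ≤ q * eLpNorm (fun ω => ∑ j ∈ Finset.range N, ENNReal.ofReal (w j ω)) q P := by
  have hq0 : q ≠ 0 := (zero_lt_one.trans_le hq).ne'
  have hq1 : 1 ≤ q.toReal := by simpa using ENNReal.toReal_mono hq' hq
  have hqq : ENNReal.ofReal q.toReal = q := ENNReal.ofReal_toReal hq'
  set c : ℕ → Ω → ℝ≥0∞ := fun j ω => ENNReal.ofReal (P[w j | ℱ j] ω)
  set v : ℕ → Ω → ℝ≥0∞ := fun j ω => ENNReal.ofReal (w j ω)
  have hcm : ∀ j, Measurable[ℱ j] (c j) := fun j =>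
    (@ENNReal.measurable_ofReal).comp stronglyMeasurable_condExp.measurable
  have hcm' : ∀ j, Measurable (c j) := fun j => (hcm j).mono (ℱ.le j) le_rfl
  have hvm : ∀ j, AEMeasurable (v j) P := fun j =>
    (hw j).aestronglyMeasurable.aemeasurable.ennreal_ofReal
  rcases eq_or_ne (eLpNorm (fun ω => ∑ j ∈ Finset.range N, v j ω) q P) ∞ with htop | hfin
  · rw [htop, ENNReal.mul_top hq0]
    exact le_top
  -- Needed to divide by a power of `I` at the end; it follows from the `L^q` contractivity of
  -- conditional expectation, term by term.
  have hcfin : eLpNorm (fun ω => ∑ j ∈ Finset.range N, c j ω) q P ≠ ∞ := by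
    refine ne_top_of_le_ne_top (ENNReal.sum_ne_top.2 fun j hj => ?_)
      (eLpNorm_ennreal_sum_le hq _ fun j => (hcm' j).aemeasurable)
    have h1 : eLpNorm (c j) q P = eLpNorm (P[w j | ℱ j]) q P := by
      refine eLpNorm_congr_enorm_ae ?_
      filter_upwards [condExp_nonneg (m := ℱ j) (.of_forall (hw0 j))] with ω hω
      rw [Real.enorm_eq_ofReal hω]
      rfl
    have h2 : eLpNorm (w j) q P ≤ eLpNorm (fun ω => ∑ j ∈ Finset.range N, v j ω) q P := by
      refine eLpNorm_mono_enorm fun ω => ?_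
      rw [Real.enorm_eq_ofReal (hw0 j ω), enorm_eq_self]
      exact Finset.single_le_sum (f := fun j => v j ω) (fun _ _ => zero_le) hj
    rw [h1]
    exact ne_top_of_le_ne_top hfin ((eLpNorm_condExp_le_eLpNorm _ hq).trans h2)
  set I := ∫⁻ ω, (∑ j ∈ Finset.range N, c j ω) ^ q.toReal ∂P with hI
  set J := ∫⁻ ω, (∑ j ∈ Finset.range N, v j ω) ^ q.toReal ∂P with hJ
  have hAm : ∀ n, Measurable[ℱ n] fun ω => ∑ j ∈ Finset.range (n + 1), c j ω := fun n =>
    @Finset.measurable_sum _ _ _ _ _ _ (ℱ n) _ _ fun j hj =>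
      (hcm j).mono (ℱ.mono (by simp at hj; omega)) le_rfl
  have hsumm : Measurable fun ω => ∑ j ∈ Finset.range N, c j ω :=
    Finset.measurable_sum _ fun j _ => hcm' j
  -- The partial sum through index `n` is `ℱ n`-measurable because `c n` itself is, so `c n` may be
  -- replaced by `v n` under the integral. Hölder then makes `I` reappear with exponent `1 - 1/q`.
  have hmain : I ≤ q * (J ^ (1 / q.toReal) * I ^ ((q.toReal - 1) / q.toReal)) := by
    calc I ≤ ∫⁻ ω, q * ∑ n ∈ Finset.range N,
          c n ω * (∑ j ∈ Finset.range (n + 1), c j ω) ^ (q.toReal - 1) ∂P := by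
          refine lintegral_mono fun ω => ?_
          have := rpow_sum_le hq1 (c := fun j => c j ω) (fun j => ENNReal.ofReal_ne_top) N
          rwa [hqq] at this
      _ = q * ∑ n ∈ Finset.range N, ∫⁻ ω,
          c n ω * (∑ j ∈ Finset.range (n + 1), c j ω) ^ (q.toReal - 1) ∂P := by
          rw [lintegral_const_mul' _ _ hq', lintegral_finsetSum]
          exact fun n _ => (hcm' n).mul (((hAm n).mono (ℱ.le n) le_rfl).pow_const _)
      _ = q * ∑ n ∈ Finset.range N, ∫⁻ ω,
          v n ω * (∑ j ∈ Finset.range (n + 1), c j ω) ^ (q.toReal - 1) ∂P := by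
          congr 1
          refine Finset.sum_congr rfl fun n _ => ?_
          exact lintegral_mul_ofReal_condExp (ℱ.le n) (hw n) (.of_forall (hw0 n))
            ((hAm n).pow_const _)
      _ ≤ q * ∑ n ∈ Finset.range N, ∫⁻ ω,
          v n ω * (∑ j ∈ Finset.range N, c j ω) ^ (q.toReal - 1) ∂P := by
          gcongr with n hn ω
          exact Finset.mem_range.1 hn
      _ = q * ∫⁻ ω, (∑ n ∈ Finset.range N, v n ω)
            * (∑ j ∈ Finset.range N, c j ω) ^ (q.toReal - 1) ∂P := by
          rw [← lintegral_finsetSum' (f := fun n ω => v n ω *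
            (∑ j ∈ Finset.range N, c j ω) ^ (q.toReal - 1)) _ fun n _ =>
              (hvm n).mul (hsumm.pow_const _).aemeasurable]
          simp_rw [Finset.sum_mul]
      _ = q * ∫⁻ ω, ((∑ n ∈ Finset.range N, v n ω) ^ q.toReal) ^ (1 / q.toReal)
            * ((∑ j ∈ Finset.range N, c j ω) ^ q.toReal) ^ ((q.toReal - 1) / q.toReal) ∂P := by
          congr 2
          funext ω
          rw [← ENNReal.rpow_mul, ← ENNReal.rpow_mul, mul_one_div_cancel (by positivity),
            ENNReal.rpow_one, mul_div_cancel₀ _ (by positivity)]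
      _ ≤ _ := by
          gcongr
          refine ENNReal.lintegral_mul_norm_pow_le
            ((Finset.aemeasurable_fun_sum _ fun j _ => hvm j).pow_const _)
            (hsumm.pow_const _).aemeasurable (by positivity)
            (div_nonneg (by linarith) (by positivity)) ?_
          field_simp
          ring
  have hIfin : I ≠ ∞ := by
    rw [hI, ← eLpNorm_ennreal_rpow hq0 hq']
    exact ENNReal.rpow_ne_top_of_nonneg (by positivity) hcfin
  rw [eLpNorm_ennreal_eq hq0 hq', eLpNorm_ennreal_eq hq0 hq', ← hI, ← hJ]
  rcases eq_or_ne I 0 with h0 | h0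
  · rw [h0, ENNReal.zero_rpow_of_pos (by positivity)]
    exact zero_le
  have hsplit : I = I ^ (1 / q.toReal) * I ^ ((q.toReal - 1) / q.toReal) := by
    rw [← ENNReal.rpow_add _ _ h0 hIfin]
    have : 1 / q.toReal + (q.toReal - 1) / q.toReal = 1 := by field_simp; ring
    rw [this, ENNReal.rpow_one]
  have hpos : I ^ ((q.toReal - 1) / q.toReal) ≠ 0 := by
    simp [ENNReal.rpow_eq_zero_iff, h0, hIfin]
  have hnt : I ^ ((q.toReal - 1) / q.toReal) ≠ ∞ :=
    ENNReal.rpow_ne_top_of_nonneg (div_nonneg (by linarith) (by positivity)) hIfin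
  rw [← ENNReal.mul_le_mul_iff_left hpos hnt, ← hsplit, mul_assoc]
  exact hmain

/-- Conditional Jensen's inequality for the `ℓ^r` norm. -/
theorem ellNorm_condExp_le {ι : Type*} [Fintype ι] {Ω : Type*} (m' : MeasurableSpace Ω)
    {m : MeasurableSpace Ω} {P : Measure Ω} {r : ℝ≥0∞} (hr : 1 ≤ r) (hr' : r ≠ ∞)
    {a : ι → Ω → ℝ} (ha : ∀ k, Integrable (a k) P) :
    ∀ᵐ ω ∂P, (ellNorm r fun k => ‖P[a k | m'] ω‖ₑ)
      ≤ ENNReal.ofReal (P[fun ω => (ellNorm r fun k => ‖a k ω‖ₑ).toReal | m'] ω) := by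
  have : Fact (1 ≤ r) := ⟨hr⟩
  have hr0 : r ≠ 0 := (zero_lt_one.trans_le hr).ne'
  have hr1 := ENNReal.toReal_pos hr0 hr'
  -- The family is viewed as one vector in a finite-dimensional `ℓ^r` space, where `norm_condExp_le`
  -- applies.
  let v : Ω → PiLp r fun _ : ι => ℝ := fun ω => WithLp.toLp r fun k => a k ω
  have hv : Integrable v P := Integrable.of_eval_piLp ha
  have hnorm : ∀ x : PiLp r fun _ : ι => ℝ, (ellNorm r fun k => ‖x k‖ₑ) = ‖x‖ₑ := by
    intro x
    rw [ellNorm, if_neg hr', tsum_fintype, ← ofReal_norm, PiLp.norm_eq_sum hr1,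
      ← ENNReal.ofReal_rpow_of_nonneg (Finset.sum_nonneg fun _ _ => by positivity) (by positivity),
      ENNReal.ofReal_sum_of_nonneg fun _ _ => by positivity]
    simp_rw [← ENNReal.ofReal_rpow_of_nonneg (norm_nonneg _) hr1.le, ofReal_norm]
  have hcoord : ∀ k, ∀ᵐ ω ∂P, P[v | m'] ω k = P[a k | m'] ω := by
    intro k
    have := ContinuousLinearMap.comp_condExp_comm (m := m') hv
      (PiLp.proj (𝕜 := ℝ) r (fun _ : ι => ℝ) k)
    filter_upwards [this] with ω hω
    exact hω
  filter_upwards [norm_condExp_le (m := m') (μ := P) v, ae_all_iff.2 hcoord] with ω h1 h2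
  simp_rw [← h2, hnorm]
  rw [← ofReal_norm]
  refine ENNReal.ofReal_le_ofReal (h1.trans_eq ?_)
  congr 1
  funext ω'
  have := hnorm (v ω')
  simp only [v] at this ⊢
  rw [this, toReal_enorm]

end CondExp

/-! ### The Davis decomposition -/

section Davis

variable {ι : Type*}

/-- The maximal `ℓ^r` norm `max_{i < n} ‖d_i‖_{ℓ^r}` of the increments. -/
noncomputable def maxIncr (r : ℝ≥0∞) (d : ι → ℕ → ℝ) (n : ℕ) : ℝ≥0∞ :=
  (Finset.range n).sup fun i => ellNorm r fun k => ‖d k i‖ₑ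

theorem maxIncr_mono (r : ℝ≥0∞) (d : ι → ℕ → ℝ) : Monotone (maxIncr r d) := fun _ _ h =>
  Finset.sup_mono (by simpa using h)

theorem maxIncr_le_ellNorm_sqPart (r : ℝ≥0∞) (d : ι → ℕ → ℝ) (n : ℕ) :
    maxIncr r d n ≤ ellNorm r fun k => sqPart (d k) n :=
  Finset.sup_le fun _ hi => ellNorm_mono fun k => enorm_le_sqPart (d k) (Finset.mem_range.1 hi)

theorem maxIncr_ne_top [Finite ι] (r : ℝ≥0∞) (d : ι → ℕ → ℝ) (n : ℕ) : maxIncr r d n ≠ ∞ :=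
  ne_top_of_le_ne_top (ellNorm_ne_top fun k => sqPart_ne_top (d k) n)
    (maxIncr_le_ellNorm_sqPart r d n)

theorem measurable_maxIncr [Countable ι] {Ω : Type*} {m : MeasurableSpace Ω} {r : ℝ≥0∞}
    {d : ι → ℕ → Ω → ℝ} {n : ℕ} (h : ∀ k, ∀ j < n, Measurable (d k j)) :
    Measurable fun ω => maxIncr r (fun k j => d k j ω) n := by
  simp only [maxIncr, Finset.sup_eq_iSup]
  refine Measurable.iSup fun i => Measurable.iSup fun hi => ?_
  exact measurable_ellNorm fun k => (h k i (Finset.mem_range.1 hi)).enorm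

/-- Each retained increment is more than twice all earlier ones, so the sum behaves like a geometric
series dominated by its last term. -/
theorem sum_large_incr_le {r : ℝ≥0∞} (hr : 1 ≤ r) {d b : ι → ℕ → ℝ}
    (hb : ∀ j, 2 * maxIncr r d j < (ellNorm r fun k => ‖d k j‖ₑ) → ∀ k, b k j = d k j)
    (hb0 : ∀ j, ¬ 2 * maxIncr r d j < (ellNorm r fun k => ‖d k j‖ₑ) → ∀ k, b k j = 0) (n : ℕ) :
    ∑ j ∈ Finset.range n, (ellNorm r fun k => ‖b k j‖ₑ) ≤ 2 * maxIncr r d n := by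
  have hr0 : r ≠ 0 := (zero_lt_one.trans_le hr).ne'
  induction n with
  | zero => simp
  | succ n ih =>
    rw [Finset.sum_range_succ]
    by_cases h : 2 * maxIncr r d n < (ellNorm r fun k => ‖d k n‖ₑ)
    · have h1 : (ellNorm r fun k => ‖d k n‖ₑ) ≤ maxIncr r d (n + 1) :=
        Finset.le_sup (f := fun i => ellNorm r fun k => ‖d k i‖ₑ)
          (Finset.mem_range.2 (Nat.lt_succ_self n))
      simp_rw [hb n h]
      calc _ ≤ maxIncr r d (n + 1) + maxIncr r d (n + 1) :=
            add_le_add (ih.trans (h.le.trans h1)) h1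
        _ = _ := (two_mul _).symm
    · simp_rw [hb0 n h, enorm_zero, ellNorm_zero hr0, add_zero]
      exact ih.trans (by gcongr; exact maxIncr_mono r d (Nat.le_succ n))

variable {Ω : Type*} {m : MeasurableSpace Ω} {ℱ : Filtration ℕ m} {P : Measure Ω}

theorem integrable_ellNorm_toReal [Fintype ι] {r : ℝ≥0∞} (hr : 1 ≤ r) {a : ι → Ω → ℝ}
    (hm : ∀ k, Measurable (a k)) (ha : ∀ k, Integrable (a k) P) :
    Integrable (fun ω => (ellNorm r fun k => ‖a k ω‖ₑ).toReal) P := by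
  classical
  have hr0 : r ≠ 0 := (zero_lt_one.trans_le hr).ne'
  have hsum : Integrable (fun ω => ∑ k, |a k ω|) P :=
    integrable_finsetSum _ fun k _ => (ha k).abs
  refine hsum.mono' (measurable_ellNorm fun k => (hm k).enorm).ennreal_toReal.aestronglyMeasurable
    (.of_forall fun ω => ?_)
  rw [Real.norm_of_nonneg ENNReal.toReal_nonneg]
  refine ENNReal.toReal_le_of_le_ofReal (Finset.sum_nonneg fun _ _ => abs_nonneg _) ?_
  rw [ENNReal.ofReal_sum_of_nonneg fun _ _ => abs_nonneg _]
  -- Expansion in unit vectors: the `ℓ^r` norm is at most the `ℓ^1` norm, which is integrable.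
  have h1 : (fun l => ‖a l ω‖ₑ) = fun l => ∑ k, if l = k then ‖a k ω‖ₑ else 0 := by
    funext l
    simp
  rw [h1]
  refine (ellNorm_sum_le hr _ _).trans (Finset.sum_le_sum fun k _ => ?_)
  have h2 : (fun l => if l = k then ‖a k ω‖ₑ else 0)
      = fun l => (‖a k ω‖₊ : ℝ≥0∞) * if l = k then 1 else 0 := by
    funext l
    simp [enorm_eq_nnnorm]
  rw [h2, ellNorm_const_mul hr0, ← Real.enorm_eq_ofReal_abs, enorm_eq_nnnorm]
  refine mul_le_of_le_one_right' ?_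
  rw [ellNorm]
  split_ifs with h
  · exact iSup_le fun l => by split_ifs <;> simp
  · have := ENNReal.toReal_pos hr0 h
    rw [tsum_fintype, Finset.sum_eq_single k (by simp +contextual [this]) (by simp)]
    simp

variable [IsProbabilityMeasure P]

open Classical in
/-- The Davis decomposition of a family of martingales, with respect to the `ℓ^r` norm. -/
theorem exists_davis_decomposition [Fintype ι] {r : ℝ≥0∞} (hr : 1 ≤ r) (hr' : r ≠ ∞)
    {d : ι → ℕ → Ω → ℝ} (hd : ∀ k, MDS ℱ P (d k)) :
    ∃ p u : ι → ℕ → Ω → ℝ, (∀ k, MDS ℱ P (p k)) ∧ (∀ k j, Measurable (u k j)) ∧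
      (∀ k j ω, d k j ω = p k j ω + u k j ω) ∧
      (∀ j, ∀ᵐ ω ∂P, (ellNorm r fun k => ‖p k j ω‖ₑ) ≤ 4 * maxIncr r (fun k i => d k i ω) j) ∧
      ∀ q : ℝ≥0∞, 1 ≤ q → q ≠ ∞ → ∀ N,
        eLpNorm (fun ω => ∑ j ∈ Finset.range N, ellNorm r fun k => ‖u k j ω‖ₑ) q P
          ≤ (2 * (1 + q)) * eLpNorm (fun ω => maxIncr r (fun k i => d k i ω) N) q P := by
  have hr0 : r ≠ 0 := (zero_lt_one.trans_le hr).ne'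
  have hdm : ∀ k j, Measurable (d k j) := fun k j => ((hd k).meas j).mono (ℱ.le _) le_rfl
  set D : ℕ → Ω → ℝ≥0∞ := fun j ω => maxIncr r (fun k i => d k i ω) j
  have hDm : ∀ j, Measurable[ℱ j] (D j) := fun j =>
    @measurable_maxIncr ι _ Ω (ℱ j) r d j fun k i hi => ((hd k).meas i).mono (ℱ.mono hi) le_rfl
  let J : ℕ → Set Ω := fun j => {ω | 2 * D j ω < ellNorm r fun k => ‖d k j ω‖ₑ}
  have hJ : ∀ j, MeasurableSet[ℱ (j + 1)] (J j) := fun j => by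
    have h1 : Measurable[ℱ (j + 1)] fun ω => 2 * D j ω :=
      ((hDm j).mono (ℱ.mono (Nat.le_succ j)) le_rfl).const_mul 2
    have h2 : Measurable[ℱ (j + 1)] fun ω => ellNorm r fun k => ‖d k j ω‖ₑ :=
      @measurable_ellNorm ι _ Ω (ℱ (j + 1)) r _ fun k => measurable_enorm.comp ((hd k).meas j)
    exact measurableSet_lt h1 h2
  let b : ι → ℕ → Ω → ℝ := fun k j => (J j).indicator (d k j)
  let c : ι → ℕ → Ω → ℝ := fun k j => (J j)ᶜ.indicator (d k j)
  have hbc : ∀ k j, b k j + c k j = d k j := fun k j => Set.indicator_self_add_compl _ _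
  have hJ' : ∀ j, MeasurableSet (J j) := fun j => ℱ.le _ _ (hJ j)
  have hbi : ∀ k j, Integrable (b k j) P := fun k j => ((hd k).int j).indicator (hJ' j)
  have hci : ∀ k j, Integrable (c k j) P := fun k j => ((hd k).int j).indicator (hJ' j).compl
  have hbm : ∀ k j, Measurable (b k j) := fun k j => (hdm k j).indicator (hJ' j)
  have hcm : ∀ k j, Measurable[ℱ (j + 1)] (c k j) := fun k j =>
    ((hd k).meas j).indicator (hJ j).compl
  have hcm' : ∀ k j, Measurable (c k j) := fun k j => (hcm k j).mono (ℱ.le _) le_rfl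
  have hEc : ∀ k j, Measurable[ℱ (j + 1)] (P[c k j | ℱ j]) := fun k j =>
    (stronglyMeasurable_condExp.measurable).mono (ℱ.mono (Nat.le_succ j)) le_rfl
  have hEbc : ∀ k j, ∀ᵐ ω ∂P, P[b k j | ℱ j] ω + P[c k j | ℱ j] ω = 0 := by
    intro k j
    have h1 := condExp_add (hbi k j) (hci k j) (ℱ j)
    rw [hbc] at h1
    filter_upwards [h1, (hd k).condExp j] with ω h1 h2
    rw [h2] at h1
    exact h1.symm
  -- Only the small part `c` is compensated. Both terms are at most `2 D j` in `ℓ^r`, the second by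
  -- conditional Jensen and because `D j` is `ℱ j`-measurable. Since `d` has conditional mean zero,
  -- the remainder is `b - P[b | ℱ j]`.
  let p : ι → ℕ → Ω → ℝ := fun k j ω => c k j ω - P[c k j | ℱ j] ω
  have hpm : ∀ k j, Measurable[ℱ (j + 1)] (p k j) := fun k j => (hcm k j).sub (hEc k j)
  have hc2D : ∀ j ω, (ellNorm r fun k => ‖c k j ω‖ₑ) ≤ 2 * D j ω := by
    intro j ω
    by_cases h : ω ∈ J j
    · simp [c, h, ellNorm_zero hr0]
    · simp only [c, Set.indicator_of_mem (Set.mem_compl h)]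
      exact not_lt.1 h
  have hDi : ∀ j, Integrable (fun ω => (2 * D j ω).toReal) P := by
    intro j
    have hsum : Integrable (fun ω => ∑ i ∈ Finset.range j,
        2 * (ellNorm r fun k => ‖d k i ω‖ₑ).toReal) P :=
      integrable_finsetSum _ fun i _ =>
        (integrable_ellNorm_toReal hr (fun k => hdm k i) fun k => (hd k).int i).const_mul 2
    refine hsum.mono' (((hDm j).mono (ℱ.le j) le_rfl).const_mul
      2).ennreal_toReal.aestronglyMeasurable (.of_forall fun ω => ?_)
    rw [Real.norm_of_nonneg ENNReal.toReal_nonneg]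
    have hne : ∀ i, (ellNorm r fun k => ‖d k i ω‖ₑ) ≠ ∞ := fun i =>
      ellNorm_ne_top fun k => enorm_ne_top
    have hDle : D j ω ≤ ∑ i ∈ Finset.range j, ellNorm r fun k => ‖d k i ω‖ₑ :=
      Finset.sup_le fun i hi => Finset.single_le_sum
        (f := fun i => ellNorm r fun k => ‖d k i ω‖ₑ) (fun _ _ => zero_le) hi
    rw [ENNReal.toReal_mul, ← Finset.mul_sum, ← ENNReal.toReal_sum fun i _ => hne i]
    gcongr
    · simp
    · exact ENNReal.sum_ne_top.2 fun i _ => hne i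
  refine ⟨p, fun k j ω => d k j ω - p k j ω, fun k => ⟨hpm k, fun j => ?_, fun j => ?_⟩,
    fun k j => (hdm k j).sub ((hpm k j).mono (ℱ.le _) le_rfl), fun k j ω => by ring, ?_, ?_⟩
  · exact (hci k j).sub integrable_condExp
  · have h1 := condExp_sub (hci k j) (integrable_condExp (f := c k j) (m := ℱ j)) (ℱ j)
    have h2 : P[P[c k j | ℱ j] | ℱ j] = P[c k j | ℱ j] :=
      condExp_of_stronglyMeasurable (ℱ.le j) stronglyMeasurable_condExp integrable_condExp
    rw [h2, sub_self] at h1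
    exact h1
  · intro j
    have h1 := ellNorm_condExp_le (ℱ j) hr hr' (P := P) fun k => hci k j
    have h2 : P[fun ω => (ellNorm r fun k => ‖c k j ω‖ₑ).toReal | ℱ j]
        ≤ᵐ[P] P[fun ω => (2 * D j ω).toReal | ℱ j] := by
      refine condExp_mono (integrable_ellNorm_toReal hr (fun k => hcm' k j) fun k => hci k j)
        (hDi j) (.of_forall fun ω => ?_)
      exact ENNReal.toReal_mono (ENNReal.mul_ne_top (by norm_num) (maxIncr_ne_top _ _ _))
        (hc2D j ω)
    have h3 : P[fun ω => (2 * D j ω).toReal | ℱ j] = fun ω => (2 * D j ω).toReal :=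
      condExp_of_stronglyMeasurable (ℱ.le j)
        ((hDm j).const_mul 2).ennreal_toReal.stronglyMeasurable (hDi j)
    rw [h3] at h2
    filter_upwards [h1, h2] with ω h1 h2
    calc (ellNorm r fun k => ‖p k j ω‖ₑ)
        ≤ ellNorm r fun k => ‖c k j ω‖ₑ + ‖P[c k j | ℱ j] ω‖ₑ :=
          ellNorm_mono fun k => enorm_sub_le
      _ ≤ 2 * D j ω + 2 * D j ω := by
          refine (ellNorm_add_le hr _ _).trans (add_le_add (hc2D j ω) (h1.trans ?_))
          exact ENNReal.ofReal_le_of_le_toReal h2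
      _ = 4 * D j ω := by ring
  · intro q hq hq' N
    let w : ℕ → Ω → ℝ := fun j ω => (ellNorm r fun k => ‖b k j ω‖ₑ).toReal
    have hwb : ∀ j ω, ENNReal.ofReal (w j ω) = ellNorm r fun k => ‖b k j ω‖ₑ := fun j ω =>
      ENNReal.ofReal_toReal (ellNorm_ne_top fun k => enorm_ne_top)
    have hwi : ∀ j, Integrable (w j) P := fun j =>
      integrable_ellNorm_toReal hr (fun k => hbm k j) fun k => hbi k j
    have hu : ∀ᵐ ω ∂P, ∀ j, (ellNorm r fun k => ‖d k j ω - p k j ω‖ₑ)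
        ≤ ENNReal.ofReal (w j ω) + ENNReal.ofReal (P[w j | ℱ j] ω) := by
      rw [ae_all_iff]
      intro j
      filter_upwards [ellNorm_condExp_le (ℱ j) hr hr' (P := P) fun k => hbi k j,
        ae_all_iff.2 fun k => hEbc k j] with ω h1 h2
      have h3 : ∀ k, d k j ω - p k j ω = b k j ω - P[b k j | ℱ j] ω := by
        intro k
        have h4 : b k j ω + c k j ω = d k j ω := congrFun (hbc k j) ω
        have h5 : p k j ω = c k j ω - P[c k j | ℱ j] ω := rfl
        linarith [h2 k]
      simp_rw [h3]
      refine (ellNorm_mono fun k => enorm_sub_le).trans ((ellNorm_add_le hr _ _).trans ?_)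
      rw [hwb]
      exact add_le_add le_rfl h1
    have hwsum : ∀ ω, ∑ j ∈ Finset.range N, ENNReal.ofReal (w j ω) ≤ 2 * D N ω := by
      intro ω
      simp_rw [hwb]
      refine sum_large_incr_le hr (d := fun k j => d k j ω) (b := fun k j => b k j ω) ?_ ?_ N
      · exact fun j h k => Set.indicator_of_mem (s := J j) h _
      · exact fun j h k => Set.indicator_of_notMem (s := J j) h _
    have hwn : eLpNorm (fun ω => ∑ j ∈ Finset.range N, ENNReal.ofReal (w j ω)) q P
        ≤ 2 * eLpNorm (D N) q P := by
      refine (eLpNorm_ennreal_mono hwsum).trans_eq ?_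
      exact_mod_cast eLpNorm_ennreal_const_mul q 2 (D N)
    calc eLpNorm (fun ω => ∑ j ∈ Finset.range N, ellNorm r fun k => ‖d k j ω - p k j ω‖ₑ) q P
        ≤ eLpNorm (fun ω => ∑ j ∈ Finset.range N, ENNReal.ofReal (w j ω)
            + ∑ j ∈ Finset.range N, ENNReal.ofReal (P[w j | ℱ j] ω)) q P := by
          refine eLpNorm_ennreal_mono_ae ?_
          filter_upwards [hu] with ω hω
          rw [← Finset.sum_add_distrib]
          exact Finset.sum_le_sum fun j _ => hω j
      _ ≤ eLpNorm (fun ω => ∑ j ∈ Finset.range N, ENNReal.ofReal (w j ω)) q P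
            + eLpNorm (fun ω => ∑ j ∈ Finset.range N, ENNReal.ofReal (P[w j | ℱ j] ω)) q P := by
          refine eLpNorm_ennreal_add_le hq ?_ ?_
          · exact Finset.aemeasurable_fun_sum _ fun j _ =>
              (hwi j).aestronglyMeasurable.aemeasurable.ennreal_ofReal
          · exact Finset.aemeasurable_fun_sum _ fun j _ =>
              integrable_condExp.aestronglyMeasurable.aemeasurable.ennreal_ofReal
      -- The factor 2 is the geometric sum of the large increments; `q` is the dual Doob constant.
      _ ≤ 2 * eLpNorm (D N) q P + q * (2 * eLpNorm (D N) q P) := by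
          refine add_le_add hwn ?_
          refine (eLpNorm_sum_condExp_le ℱ hwi (fun j ω => ENNReal.toReal_nonneg) hq hq' N).trans ?_
          gcongr
      _ = _ := by ring

end Davis

/-! ### Martingale transforms in `L^q(ℓ^r)` for finite families -/

section FiniteEstimate

theorem maxSum_mul_le (f u : ℕ → ℝ) (n : ℕ) :
    maxSum (fun j => f j * u j) n ≤ maxAbs f n * ∑ j ∈ Finset.range n, ‖u j‖ₑ := by
  refine (maxSum_le_sum _ _).trans ?_
  rw [Finset.mul_sum]
  refine Finset.sum_le_sum fun j hj => ?_
  rw [enorm_mul]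
  gcongr
  exact Finset.le_sup (f := fun j => ‖f j‖ₑ) hj

/-- The weak type inequality for the exponent `r` implies the estimate for martingale transforms in
`L^q(ℓ^r)`. -/
theorem eLpNorm_transform_le_of_weakBDG.{u, v} {q q₀ q₁ r r₀ r₁ : ℝ≥0∞}
    (hq : q ≠ 0) (hq' : q ≠ ∞) (hq₁ : q₁ ≠ 0) (hq₀ : 1 ≤ q₀) (hq₀' : q₀ ≠ ∞)
    (hr : 1 ≤ r) (hr' : r ≠ ∞) (hr₀ : 1 ≤ r₀) (hr₀' : r₀ ≠ ∞) (hr₁ : 1 ≤ r₁)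
    (hqq : 1 / q = 1 / q₀ + 1 / q₁) (hrr : 1 / r = 1 / r₀ + 1 / r₁) (C : ℝ≥0) :
    ∃ C' : ℝ≥0, ∀ (ι : Type v) [Fintype ι], WeakBDG.{u, v} ι r C →
    ∀ (Ω : Type u) [m : MeasurableSpace Ω] (P : Measure Ω) [IsProbabilityMeasure P]
    (ℱ : Filtration ℕ m) (d f : ι → ℕ → Ω → ℝ), (∀ k, MDS ℱ P (d k)) →
    (∀ k j, Measurable[ℱ j] (f k j)) → ∀ N : ℕ,
    eLpNorm (fun ω => ellNorm r fun k => maxSum (fun j => f k j ω * d k j ω) N) q P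
      ≤ C' * eLpNorm (fun ω => ellNorm r₁ fun k => maxAbs (fun j => f k j ω) N) q₁ P
        * eLpNorm (fun ω => ellNorm r₀ fun k => sqPart (fun j => d k j ω) N) q₀ P := by
  obtain ⟨C₁, hC₁⟩ := eLpNorm_maxSum_le_of_weakBDG.{u, v} hr hr' hq hq' C
  have hr0 : r ≠ 0 := (zero_lt_one.trans_le hr).ne'
  have hr₀0 : r₀ ≠ 0 := (zero_lt_one.trans_le hr₀).ne'
  have hr₁0 : r₁ ≠ 0 := (zero_lt_one.trans_le hr₁).ne'
  have hq₀0 : q₀ ≠ 0 := (zero_lt_one.trans_le hq₀).ne'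
  rw [add_comm] at hqq hrr
  let A : ℝ≥0∞ := 2 * (1 + q₀)
  -- `A` is the Davis constant for `u` in `L^{q₀}`, `C₁ * (5 + A)` comes from `p`, and `LpAddConst`
  -- accounts for the quasi-triangle inequality when `q < 1`.
  let K : ℝ≥0∞ := ENNReal.LpAddConst q * (C₁ * (5 + A) + A)
  have hK : K ≠ ∞ := by
    have hA : A ≠ ∞ := ENNReal.mul_ne_top (by norm_num) (ENNReal.add_ne_top.2 ⟨by norm_num, hq₀'⟩)
    exact ENNReal.mul_ne_top (ENNReal.LpAddConst_lt_top q).ne (ENNReal.add_ne_top.2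
      ⟨ENNReal.mul_ne_top (by simp) (ENNReal.add_ne_top.2 ⟨by norm_num, hA⟩), hA⟩)
  refine ⟨K.toNNReal, ?_⟩
  intro ι _ hC Ω m P _ ℱ d f hd hf N
  rw [ENNReal.coe_toNNReal hK]
  obtain ⟨p, u, hp, hum, hdpu, hpD, hu⟩ := exists_davis_decomposition hr₀ hr₀' hd
  have hdm : ∀ k j, Measurable (d k j) := fun k j => ((hd k).meas j).mono (ℱ.le _) le_rfl
  have hpm : ∀ k j, Measurable (p k j) := fun k j => ((hp k).meas j).mono (ℱ.le _) le_rfl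
  have hfm : ∀ k j, Measurable (f k j) := fun k j => (hf k j).mono (ℱ.le _) le_rfl
  set Φ : Ω → ℝ≥0∞ := fun ω => ellNorm r₁ fun k => maxAbs (fun j => f k j ω) N
  set S : Ω → ℝ≥0∞ := fun ω => ellNorm r₀ fun k => sqPart (fun j => d k j ω) N
  let U : Ω → ℝ≥0∞ := fun ω => ∑ j ∈ Finset.range N, ellNorm r₀ fun k => ‖u k j ω‖ₑ
  have hΦm : Measurable Φ := measurable_ellNorm fun k => measurable_maxAbs fun j _ => hfm k j
  have hSm : Measurable S := measurable_ellNorm fun k => measurable_sqPart fun j _ => hdm k j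
  have hUm : Measurable U := Finset.measurable_sum _ fun j _ =>
    measurable_ellNorm fun k => (hum k j).enorm
  have hUS : eLpNorm U q₀ P ≤ A * eLpNorm S q₀ P := by
    refine (hu q₀ hq₀ hq₀' N).trans ?_
    gcongr
    exact eLpNorm_ennreal_mono fun ω => maxIncr_le_ellNorm_sqPart r₀ (fun k j => d k j ω) N
  have hUle : ∀ ω, (ellNorm r₀ fun k => ∑ j ∈ Finset.range N, ‖u k j ω‖ₑ) ≤ U ω := fun ω =>
    ellNorm_sum_le hr₀ (Finset.range N) fun j k => ‖u k j ω‖ₑ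
  have hbv : eLpNorm (fun ω => ellNorm r fun k => maxSum (fun j => f k j ω * u k j ω) N) q P
      ≤ A * (eLpNorm Φ q₁ P * eLpNorm S q₀ P) := by
    calc _ ≤ eLpNorm (fun ω => Φ ω * U ω) q P := by
          refine eLpNorm_ennreal_mono fun ω => ?_
          refine (ellNorm_mono fun k => maxSum_mul_le _ _ N).trans ?_
          refine (ellNorm_mul_le hr₁0 hr₀0 hr0 hrr _ _).trans ?_
          gcongr
          exact hUle ω
      _ ≤ eLpNorm Φ q₁ P * eLpNorm U q₀ P :=
          eLpNorm_ennreal_mul_le hq₁ hq₀0 hqq hΦm.aemeasurable hUm.aemeasurable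
      _ ≤ eLpNorm Φ q₁ P * (A * eLpNorm S q₀ P) := by gcongr
      _ = _ := by ring
  -- The predictable majorant: `f n` is known at time `n`, and the Davis bound replaces the still
  -- unknown increment `p n` by earlier increments of `d`.
  let Z : ℕ → Ω → ℝ≥0∞ := fun n ω => (ellNorm r₁ fun k => maxAbs (fun j => f k j ω) (n + 1)) *
    ((ellNorm r₀ fun k => sqPart (fun j => p k j ω) n) + 4 * maxIncr r₀ (fun k j => d k j ω) n)
  -- Since `p = d - u`, its square function is at most `S + U`; the term `4 * maxIncr` adds `4 * S`.
  let V : Ω → ℝ≥0∞ := fun ω => Φ ω * (5 * S ω + U ω)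
  have hpred : eLpNorm (fun ω => ellNorm r fun k => maxSum (fun j => f k j ω * p k j ω) N) q P
      ≤ C₁ * eLpNorm V q P := by
    refine hC₁ ι hC Ω P ℱ p f hp hf N Z V ?_ ?_ ?_ ?_ ?_
    · intro n
      have h1 : Measurable[ℱ n] fun ω => ellNorm r₁ fun k => maxAbs (fun j => f k j ω) (n + 1) :=
        @measurable_ellNorm ι _ Ω (ℱ n) _ _ fun k => @measurable_maxAbs Ω (ℱ n) _ _ fun j hj =>
          (hf k j).mono (ℱ.mono (by omega)) le_rfl
      have h2 : Measurable[ℱ n] fun ω => ellNorm r₀ fun k => sqPart (fun j => p k j ω) n :=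
        @measurable_ellNorm ι _ Ω (ℱ n) _ _ fun k => @measurable_sqPart Ω (ℱ n) _ _ fun j hj =>
          ((hp k).meas j).mono (ℱ.mono hj) le_rfl
      have h3 : Measurable[ℱ n] fun ω => maxIncr r₀ (fun k j => d k j ω) n :=
        @measurable_maxIncr ι _ Ω (ℱ n) r₀ d n fun k j hj =>
          ((hd k).meas j).mono (ℱ.mono hj) le_rfl
      exact h1.mul (h2.add (h3.const_mul 4))
    · exact hΦm.mul ((hSm.const_mul 5).add hUm)
    · intro ω
      refine ENNReal.mul_ne_top (ellNorm_ne_top fun k => maxAbs_ne_top _ _)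
        (ENNReal.add_ne_top.2 ⟨ENNReal.mul_ne_top (by norm_num)
          (ellNorm_ne_top fun k => sqPart_ne_top _ _), ENNReal.sum_ne_top.2 fun j _ =>
          ellNorm_ne_top fun k => enorm_ne_top⟩)
    · intro n hn ω
      have h1 : (ellNorm r₁ fun k => maxAbs (fun j => f k j ω) (n + 1)) ≤ Φ ω :=
        ellNorm_mono fun k => maxAbs_mono _ hn
      have h2 : (ellNorm r₀ fun k => sqPart (fun j => p k j ω) n) ≤ S ω + U ω := by
        refine le_trans (ellNorm_mono fun k => ?_)
          ((ellNorm_add_le hr₀ (fun k => sqPart (fun j => d k j ω) N)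
            fun k => ∑ j ∈ Finset.range N, ‖u k j ω‖ₑ).trans (add_le_add le_rfl (hUle ω)))
        refine (sqPart_mono _ hn.le).trans ?_
        have e : (fun j => p k j ω) = fun j => d k j ω + -u k j ω := by
          funext j
          rw [hdpu k j ω]
          ring
        rw [e]
        refine (sqPart_add_le _ _ N).trans (add_le_add le_rfl ?_)
        simpa using sqPart_le_sum (fun j => -u k j ω) N
      have h3 : maxIncr r₀ (fun k j => d k j ω) n ≤ S ω :=
        (maxIncr_mono _ _ hn.le).trans (maxIncr_le_ellNorm_sqPart r₀ _ N)
      calc Z n ω ≤ Φ ω * ((S ω + U ω) + 4 * S ω) := by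
            simp only [Z]
            gcongr
        _ = V ω := by simp only [V]; ring
    · intro n hn
      filter_upwards [hpD n] with ω hω
      refine (ellNorm_mono fun k => sqPart_mul_le _ _ (n + 1)).trans ?_
      refine (ellNorm_mul_le hr₁0 hr₀0 hr0 hrr _ _).trans ?_
      simp only [Z]
      gcongr
      refine (ellNorm_mono fun k => sqPart_succ_le _ n).trans ?_
      exact (ellNorm_add_le hr₀ _ _).trans (add_le_add le_rfl hω)
  have hV : eLpNorm V q P ≤ (5 + A) * (eLpNorm Φ q₁ P * eLpNorm S q₀ P) := by
    calc eLpNorm V q P ≤ eLpNorm Φ q₁ P * eLpNorm (fun ω => 5 * S ω + U ω) q₀ P :=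
          eLpNorm_ennreal_mul_le hq₁ hq₀0 hqq hΦm.aemeasurable
            ((hSm.const_mul 5).add hUm).aemeasurable
      _ ≤ eLpNorm Φ q₁ P * (5 * eLpNorm S q₀ P + A * eLpNorm S q₀ P) := by
          gcongr
          refine (eLpNorm_ennreal_add_le hq₀ (hSm.const_mul 5).aemeasurable hUm.aemeasurable).trans ?_
          refine add_le_add (le_of_eq ?_) hUS
          exact_mod_cast eLpNorm_ennreal_const_mul q₀ 5 S
      _ = _ := by ring
  calc eLpNorm (fun ω => ellNorm r fun k => maxSum (fun j => f k j ω * d k j ω) N) q P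
      ≤ eLpNorm ((fun ω => ellNorm r fun k => maxSum (fun j => f k j ω * p k j ω) N)
          + fun ω => ellNorm r fun k => maxSum (fun j => f k j ω * u k j ω) N) q P := by
        refine eLpNorm_ennreal_mono fun ω => ?_
        refine le_trans (ellNorm_mono fun k => ?_) (ellNorm_add_le hr _ _)
        simp_rw [hdpu, mul_add]
        exact maxSum_add_le _ _ N
    _ ≤ ENNReal.LpAddConst q * (C₁ * ((5 + A) * (eLpNorm Φ q₁ P * eLpNorm S q₀ P))
          + A * (eLpNorm Φ q₁ P * eLpNorm S q₀ P)) := by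
        refine (eLpNorm_add_le' ?_ ?_ q).trans ?_
        · exact (measurable_ellNorm fun k => measurable_maxSum fun j _ =>
            (hfm k j).mul (hpm k j)).aestronglyMeasurable
        · exact (measurable_ellNorm fun k => measurable_maxSum fun j _ =>
            (hfm k j).mul (hum k j)).aestronglyMeasurable
        · gcongr
          exact hpred.trans (by gcongr)
    _ = _ := by simp only [K]; ring

/-- The Burkholder–Davis–Gundy inequality, in weak form, in `ℓ^r` with exponent `r`. -/
theorem exists_weakBDG.{u, v} {r : ℝ≥0∞} (hr : 1 ≤ r) (hr' : r ≠ ∞) :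
    ∃ C : ℝ≥0, ∀ (ι : Type v) [Fintype ι], WeakBDG.{u, v} ι r C := by
  have hr0 : r ≠ 0 := (zero_lt_one.trans_le hr).ne'
  have hr1 := ENNReal.toReal_pos hr0 hr'
  -- First run of the argument, with one martingale and integrand 1: the scalar inequality in `L^r`,
  -- from the weak type inequality at exponent 2.
  obtain ⟨C, hC⟩ := eLpNorm_transform_le_of_weakBDG.{u, 0} (q := r) (q₀ := r) (q₁ := ∞)
    (r := 2) (r₀ := 2) (r₁ := ∞) hr0 hr' (by simp) hr hr' (by norm_num) (by norm_num) (by norm_num)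
    (by norm_num) (by simp) (by simp) (by simp) 1
  refine ⟨C ^ r.toReal, fun ι _ Ω m P _ ℱ e B he _ n l => ?_⟩
  have hem : ∀ k j, Measurable (e k j) := fun k j => ((he k).meas j).mono (ℱ.le _) le_rfl
  have scalar : ∀ k, ∫⁻ ω, maxSum (fun j => e k j ω) n ^ r.toReal ∂P
      ≤ (C : ℝ≥0∞) ^ r.toReal * ∫⁻ ω, sqPart (fun j => e k j ω) n ^ r.toReal ∂P := by
    intro k
    have h := hC Unit weakBDG_two_unit Ω P ℱ (fun _ => e k) (fun _ _ _ => 1) (fun _ => he k)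
      (fun _ _ => measurable_const) n
    have h1 : eLpNorm (fun _ : Ω => ellNorm ∞ fun _ : Unit => maxAbs (fun _ => (1 : ℝ)) n) ∞ P
        ≤ 1 := by
      rw [eLpNorm_exponent_top]
      refine eLpNormEssSup_le_of_ae_enorm_bound (.of_forall fun ω => ?_)
      rw [enorm_eq_self, ellNorm_unique (by simp)]
      exact Finset.sup_le fun j _ => by simp
    simp only [one_mul, ellNorm_unique (show (2 : ℝ≥0∞) ≠ 0 by norm_num)] at h
    rw [← eLpNorm_ennreal_rpow hr0 hr', ← eLpNorm_ennreal_rpow hr0 hr',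
      ← ENNReal.mul_rpow_of_nonneg _ _ hr1.le]
    gcongr
    refine h.trans ?_
    gcongr
    exact mul_le_of_le_one_right' h1
  rw [ENNReal.coe_rpow_of_nonneg _ hr1.le]
  calc (l : ℝ≥0∞) ^ r.toReal * P {ω | l < ellNorm r fun k => maxSum (fun j => e k j ω) n}
      ≤ (l : ℝ≥0∞) ^ r.toReal * P {ω | (l : ℝ≥0∞) ^ r.toReal
          ≤ (ellNorm r fun k => maxSum (fun j => e k j ω) n) ^ r.toReal} := by
        gcongr with ω
        intro hω
        exact ENNReal.rpow_le_rpow hω.le hr1.le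
    _ ≤ ∫⁻ ω, (ellNorm r fun k => maxSum (fun j => e k j ω) n) ^ r.toReal ∂P := by
        refine mul_meas_ge_le_lintegral ?_ _
        exact (measurable_ellNorm fun k => measurable_maxSum fun j _ => hem k j).pow_const _
    _ = ∑ k, ∫⁻ ω, maxSum (fun j => e k j ω) n ^ r.toReal ∂P := by
        simp_rw [ellNorm_rpow hr0 hr']
        exact lintegral_finsetSum _ fun k _ =>
          (measurable_maxSum fun j _ => hem k j).pow_const _
    _ ≤ ∑ k, (C : ℝ≥0∞) ^ r.toReal * ∫⁻ ω, sqPart (fun j => e k j ω) n ^ r.toReal ∂P :=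
        Finset.sum_le_sum fun k _ => scalar k
    _ = _ := by
        rw [← Finset.mul_sum]
        simp_rw [ellNorm_rpow hr0 hr']
        rw [lintegral_finsetSum _ fun k _ => (measurable_sqPart fun j _ => hem k j).pow_const _]

/-- Second run, now fed with the `ℓ^r`-valued weak type inequality. -/
theorem exists_eLpNorm_transform_le.{u, v} {q q₀ q₁ r r₀ r₁ : ℝ≥0∞}
    (hq : q ≠ 0) (hq' : q ≠ ∞) (hq₁ : q₁ ≠ 0) (hq₀ : 1 ≤ q₀) (hq₀' : q₀ ≠ ∞)
    (hr : 1 ≤ r) (hr' : r ≠ ∞) (hr₀ : 1 ≤ r₀) (hr₀' : r₀ ≠ ∞) (hr₁ : 1 ≤ r₁)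
    (hqq : 1 / q = 1 / q₀ + 1 / q₁) (hrr : 1 / r = 1 / r₀ + 1 / r₁) :
    ∃ C : ℝ≥0, ∀ (ι : Type v) [Fintype ι]
    (Ω : Type u) [m : MeasurableSpace Ω] (P : Measure Ω) [IsProbabilityMeasure P]
    (ℱ : Filtration ℕ m) (d f : ι → ℕ → Ω → ℝ), (∀ k, MDS ℱ P (d k)) →
    (∀ k j, Measurable[ℱ j] (f k j)) → ∀ N : ℕ,
    eLpNorm (fun ω => ellNorm r fun k => maxSum (fun j => f k j ω * d k j ω) N) q P
      ≤ C * eLpNorm (fun ω => ellNorm r₁ fun k => maxAbs (fun j => f k j ω) N) q₁ P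
        * eLpNorm (fun ω => ellNorm r₀ fun k => sqPart (fun j => d k j ω) N) q₀ P := by
  obtain ⟨C, hC⟩ := exists_weakBDG.{u, v} hr hr'
  obtain ⟨C', hC'⟩ := eLpNorm_transform_le_of_weakBDG.{u, v} hq hq' hq₁ hq₀ hq₀' hr hr' hr₀ hr₀'
    hr₁ hqq hrr C
  exact ⟨C', fun ι _ Ω m P _ ℱ d f hd hf N => hC' ι (hC ι) Ω P ℱ d f hd hf N⟩

end FiniteEstimate

/-! ### Pathwise reduction of paraproducts to transforms -/

section Deterministic

theorem lt_cast_succ_iff {a : WithTop ℕ} {j : ℕ} :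
    a < ((j + 1 : ℕ) : WithTop ℕ) ↔ a ≤ (j : WithTop ℕ) := by
  induction a with
  | top => simp
  | coe a =>
    change ((a : ℕ) : WithTop ℕ) < _ ↔ ((a : ℕ) : WithTop ℕ) ≤ _
    rw [Nat.cast_lt, Nat.cast_le, Nat.lt_succ_iff]

theorem cast_succ_le_iff {b : WithTop ℕ} {j : ℕ} :
    ((j + 1 : ℕ) : WithTop ℕ) ≤ b ↔ (j : WithTop ℕ) < b := by
  rw [← not_iff_not, not_le, not_lt, lt_cast_succ_iff]

theorem eq_cast_untopD {a : WithTop ℕ} {s : ℕ} (h : a ≤ (s : WithTop ℕ)) :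
    a = ((a.untopD 0 : ℕ) : WithTop ℕ) ∧ a.untopD 0 ≤ s := by
  induction a with
  | top => simp at h
  | coe a => exact ⟨rfl, (Nat.cast_le (α := WithTop ℕ)).1 h⟩

open Classical in
/-- The increments of `g` in the stochastic interval `(a, b]`; the `j`-th one is `dg_{j+1}`. -/
noncomputable def localIncr (g : ℕ → ℝ) (a b : WithTop ℕ) (j : ℕ) : ℝ :=
  if a ≤ (j : WithTop ℕ) ∧ (j : WithTop ℕ) < b then diff g (j + 1) else 0

open Classical in
/-- The integrand `F_{a, j}` on the stochastic interval `[a, b)`. -/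
noncomputable def localIntegrand (F : ℕ → ℕ → ℝ) (a b : WithTop ℕ) (j : ℕ) : ℝ :=
  if a ≤ (j : WithTop ℕ) ∧ (j : WithTop ℕ) < b then F (a.untopD 0) j else 0

theorem sum_Ioc_eq_sum_Ico (x : ℕ → ℝ) (s t : ℕ) :
    ∑ j ∈ Finset.Ioc s t, x j = ∑ j ∈ Finset.Ico s t, x (j + 1) := by
  rw [Finset.sum_Ico_add' x s t 1]
  refine Finset.sum_congr (Finset.ext fun j => ?_) fun _ _ => rfl
  simp only [Finset.mem_Ioc, Finset.mem_Ico]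
  omega

/-- After the shift `j ↦ j + 1` the terms with `j < a` vanish, so the sum may start at 0 for every
path, whatever the random left endpoint. -/
theorem paraprod_eq_sum_local (F : ℕ → ℕ → ℝ) (g : ℕ → ℝ) {a b : WithTop ℕ} {t : ℕ}
    (hat : a ≤ (t : WithTop ℕ)) (htb : (t : WithTop ℕ) ≤ b) :
    paraprod F g (a.untopD 0) t
      = ∑ j ∈ Finset.range t, localIntegrand F a b j * localIncr g a b j := by
  obtain ⟨ha, hat'⟩ := eq_cast_untopD hat
  rw [paraprod, sum_Ioc_eq_sum_Ico (fun j => F (a.untopD 0) (j - 1) * diff g j),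
    ← Finset.sum_range_add_sum_Ico _ hat', Finset.sum_eq_zero (s := Finset.range _), zero_add]
  · refine Finset.sum_congr rfl fun j hj => ?_
    rw [Finset.mem_Ico] at hj
    have h1 : a ≤ (j : WithTop ℕ) := by rw [ha]; exact_mod_cast hj.1
    have h2 : (j : WithTop ℕ) < b := lt_of_lt_of_le (by exact_mod_cast hj.2) htb
    simp [localIntegrand, localIncr, h1, h2]
  · intro j hj
    have h1 : ¬ a ≤ (j : WithTop ℕ) := by
      rw [ha, not_le]; exact_mod_cast Finset.mem_range.1 hj
    simp [localIntegrand, h1]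

theorem supParaprodFrom_le (F : ℕ → ℕ → ℝ) (g : ℕ → ℝ) (a b : WithTop ℕ) :
    supParaprodFrom F g a b
      ≤ ⨆ N, maxSum (fun j => localIntegrand F a b j * localIncr g a b j) N := by
  refine iSup₂_le fun t ht => le_iSup_of_le t ?_
  rw [paraprod_eq_sum_local F g ht.1 ht.2]
  exact enorm_sum_le_maxSum (fun j => localIntegrand F a b j * localIncr g a b j) le_rfl

theorem maxAbs_localIntegrand_le (F : ℕ → ℕ → ℝ) (a b : WithTop ℕ) (N : ℕ) :
    maxAbs (localIntegrand F a b) N ≤ supFrom F a b := by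
  refine Finset.sup_le fun j _ => ?_
  rw [localIntegrand]
  split_ifs with h
  · exact le_iSup₂_of_le j h le_rfl
  · simp

theorem sqPart_localIncr_le (g : ℕ → ℝ) (a b : WithTop ℕ) (N : ℕ) :
    sqPart (localIncr g a b) N ≤ sqFun g a b := by
  rw [sqPart, sqFun]
  gcongr
  let S : Set ℕ := {j | a < (j : WithTop ℕ) ∧ (j : WithTop ℕ) ≤ b}
  have h1 : ∀ j, ‖localIncr g a b j‖ₑ ^ (2 : ℝ)
      = S.indicator (fun i => ‖diff g i‖ₑ ^ 2) (j + 1) := by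
    intro j
    by_cases h : a ≤ (j : WithTop ℕ) ∧ (j : WithTop ℕ) < b
    · have : j + 1 ∈ S := ⟨lt_cast_succ_iff.2 h.1, cast_succ_le_iff.2 h.2⟩
      rw [Set.indicator_of_mem this, localIncr, if_pos h, ENNReal.rpow_two]
    · have : j + 1 ∉ S := fun h' => h ⟨lt_cast_succ_iff.1 h'.1, cast_succ_le_iff.1 h'.2⟩
      rw [Set.indicator_of_notMem this, localIncr, if_neg h]
      simp
  simp_rw [h1]
  calc ∑ j ∈ Finset.range N, S.indicator (fun i => ‖diff g i‖ₑ ^ 2) (j + 1)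
      ≤ ∑' j, S.indicator (fun i => ‖diff g i‖ₑ ^ 2) (j + 1) := ENNReal.sum_le_tsum _
    _ ≤ ∑' j, S.indicator (fun i => ‖diff g i‖ₑ ^ 2) j :=
        ENNReal.tsum_comp_le_tsum_of_injective (add_left_injective 1) _
    _ = ∑' j : S, ‖diff g j‖ₑ ^ 2 := (tsum_subtype S fun i => ‖diff g i‖ₑ ^ 2).symm

theorem supFrom_le_supTwo (F : ℕ → ℕ → ℝ) (a b : WithTop ℕ) : supFrom F a b ≤ supTwo F a b := by
  refine iSup₂_le fun t ht => ?_
  obtain ⟨ha, hat⟩ := eq_cast_untopD ht.1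
  exact le_iSup_of_le (a.untopD 0) (le_iSup₂_of_le t ⟨ha.le, hat, ht.2.le⟩ le_rfl)

/-- Replacing `F_{s,·}` by `F_{a,·}` on `(s,t]` costs exactly the paraproduct of `δ_a F`; what is
left is a difference of two paraproducts started at `a`, whence the factor 2. -/
theorem supParaprod_le (F : ℕ → ℕ → ℝ) (g : ℕ → ℝ) (a b : WithTop ℕ) :
    supParaprod F g a b
      ≤ supParaprod (deltaFst (a.untopD 0) F) g a b + 2 * supParaprodFrom F g a b := by
  refine iSup_le fun s => iSup₂_le fun t h => ?_
  obtain ⟨has, hst, htb⟩ := h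
  obtain ⟨ha, has'⟩ := eq_cast_untopD has
  have hst' : (s : WithTop ℕ) ≤ (t : WithTop ℕ) := by exact_mod_cast hst.le
  have key : paraprod F g s t = (paraprod F g (a.untopD 0) t - paraprod F g (a.untopD 0) s)
      - paraprod (deltaFst (a.untopD 0) F) g s t := by
    have h1 := Finset.sum_Ioc_consecutive
      (fun j => F (a.untopD 0) (j - 1) * diff g j) has' hst.le
    simp only [paraprod, deltaFst, sub_mul, Finset.sum_sub_distrib]
    linarith
  have hD : ‖paraprod (deltaFst (a.untopD 0) F) g s t‖ₑ
      ≤ supParaprod (deltaFst (a.untopD 0) F) g a b :=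
    le_iSup_of_le s (le_iSup₂_of_le (f := fun t _ => ‖paraprod (deltaFst (a.untopD 0) F) g s t‖ₑ)
      t ⟨has, hst, htb⟩ le_rfl)
  have ht : ‖paraprod F g (a.untopD 0) t‖ₑ ≤ supParaprodFrom F g a b :=
    le_iSup₂_of_le (f := fun t _ => ‖paraprod F g (a.untopD 0) t‖ₑ) t ⟨has.trans hst', htb⟩ le_rfl
  have hs : ‖paraprod F g (a.untopD 0) s‖ₑ ≤ supParaprodFrom F g a b :=
    le_iSup₂_of_le (f := fun t _ => ‖paraprod F g (a.untopD 0) t‖ₑ) s ⟨has, hst'.trans htb⟩ le_rfl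
  rw [key, add_comm, two_mul]
  exact enorm_sub_le.trans (add_le_add (enorm_sub_le.trans (add_le_add ht hs)) hD)

end Deterministic

/-! ### Passage to infinitely many indices and infinite time -/

section Exhaustion

theorem ellNorm_comp_le {ι κ : Type*} {r : ℝ≥0∞} {φ : κ → ι} (hφ : Function.Injective φ)
    (a : ι → ℝ≥0∞) : (ellNorm r fun k => a (φ k)) ≤ ellNorm r a := by
  rw [ellNorm, ellNorm]
  split_ifs
  · exact iSup_comp_le a φ
  · gcongr
    exact ENNReal.tsum_comp_le_tsum_of_injective hφ fun k => a k ^ r.toReal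

theorem iSup_rpow {κ : Type*} (x : κ → ℝ≥0∞) {q : ℝ} (hq : 0 < q) :
    (⨆ i, x i) ^ q = ⨆ i, x i ^ q :=
  (ENNReal.orderIsoRpow q hq).map_iSup x

/-- Every finite partial sum lives in some window `[-M, M]`; by monotonicity a single `N` can serve
as both window size and time. -/
theorem ellNorm_iSup_le {r : ℝ≥0∞} (hr : r ≠ 0) (hr' : r ≠ ∞) {x : ℤ → ℕ → ℝ≥0∞}
    (hx : ∀ k, Monotone (x k)) :
    (ellNorm r fun k => ⨆ N, x k N)
      ≤ ⨆ N : ℕ, ellNorm r fun k : Finset.Icc (-N : ℤ) N => x k N := by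
  have hr1 := ENNReal.toReal_pos hr hr'
  simp only [ellNorm, if_neg hr']
  rw [← iSup_rpow _ (by positivity)]
  gcongr
  rw [ENNReal.tsum_eq_iSup_sum]
  refine iSup_le fun s => ?_
  simp_rw [iSup_rpow _ hr1]
  rw [ENNReal.finsetSum_iSup_of_monotone fun k M N h => ENNReal.rpow_le_rpow (hx k h) hr1.le]
  refine iSup_le fun N => ?_
  obtain ⟨M, hM⟩ : ∃ M : ℕ, ∀ k ∈ s, |k| ≤ M := by
    refine ⟨∑ k ∈ s, k.natAbs, fun k hk => ?_⟩
    rw [Int.abs_eq_natAbs]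
    exact_mod_cast Finset.single_le_sum (f := Int.natAbs) (fun _ _ => Nat.zero_le _) hk
  refine le_iSup_of_le (max M N) ?_
  rw [tsum_fintype, Finset.sum_coe_sort (Finset.Icc (-((max M N : ℕ) : ℤ)) (max M N : ℕ))
    fun k => x k (max M N) ^ r.toReal]
  calc ∑ k ∈ s, x k N ^ r.toReal ≤ ∑ k ∈ s, x k (max M N) ^ r.toReal := by
        gcongr with k
        exact hx k (le_max_right _ _)
    _ ≤ _ := by
        refine Finset.sum_le_sum_of_subset fun k hk => ?_
        have h1 := abs_le.1 (hM k hk)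
        have h2 : (M : ℤ) ≤ (max M N : ℕ) := by exact_mod_cast le_max_left M N
        rw [Finset.mem_Icc]
        constructor <;> linarith [h1.1, h1.2]

theorem eLpNorm_iSup_le {Ω : Type*} {m : MeasurableSpace Ω} {P : Measure Ω} {q : ℝ≥0∞}
    (hq : q ≠ 0) (hq' : q ≠ ∞) {y : ℕ → Ω → ℝ≥0∞} (hy : ∀ N, Measurable (y N))
    (hmono : ∀ ω, Monotone fun N => y N ω) {R : ℝ≥0∞} (h : ∀ N, eLpNorm (y N) q P ≤ R) :
    eLpNorm (fun ω => ⨆ N, y N ω) q P ≤ R := by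
  have hq0 := ENNReal.toReal_pos hq hq'
  rw [← ENNReal.rpow_le_rpow_iff hq0, eLpNorm_ennreal_rpow hq hq']
  simp_rw [iSup_rpow _ hq0]
  rw [lintegral_iSup (fun N => (hy N).pow_const _)
    fun M N hMN ω => ENNReal.rpow_le_rpow (hmono ω hMN) hq0.le]
  refine iSup_le fun N => ?_
  rw [← eLpNorm_ennreal_rpow hq hq']
  exact ENNReal.rpow_le_rpow (h N) hq0.le

end Exhaustion

/-! ### Measurability at stopping times -/

section Localization

variable {Ω : Type*} {m : MeasurableSpace Ω} {ℱ : Filtration ℕ m} {P : Measure Ω}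

theorem mds_diff {g : ℕ → Ω → ℝ} (hg : Martingale g ℱ P) :
    MDS ℱ P (fun j ω => diff (fun n => g n ω) (j + 1)) where
  meas j := (hg.1 (j + 1)).measurable.sub
    ((hg.1 j).measurable.mono (ℱ.mono (Nat.le_succ j)) le_rfl)
  int j := (hg.integrable (j + 1)).sub (hg.integrable j)
  condExp j := by
    have h1 := condExp_sub (hg.integrable (j + 1)) (hg.integrable j) (ℱ j)
    refine h1.trans ?_
    filter_upwards [hg.2 j (j + 1) (Nat.le_succ j), hg.2 j j le_rfl] with ω h2 h3
    simp [h2, h3]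

theorem measurableSet_active {τ' τ : Ω → WithTop ℕ} (hτ' : IsStoppingTime ℱ τ')
    (hτ : IsStoppingTime ℱ τ) (j : ℕ) :
    MeasurableSet[ℱ j] {ω | τ' ω ≤ (j : WithTop ℕ) ∧ (j : WithTop ℕ) < τ ω} :=
  (hτ'.measurableSet_le j).inter (hτ.measurableSet_gt j)

theorem mds_localIncr {g : ℕ → Ω → ℝ} (hg : Martingale g ℱ P) {τ' τ : Ω → WithTop ℕ}
    (hτ' : IsStoppingTime ℱ τ') (hτ : IsStoppingTime ℱ τ) :
    MDS ℱ P (fun j ω => localIncr (fun n => g n ω) (τ' ω) (τ ω) j) := by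
  have hS := measurableSet_active hτ' hτ
  have heq : (fun (j : ℕ) ω => localIncr (fun n => g n ω) (τ' ω) (τ ω) j) = fun (j : ℕ) ω =>
      {ω | τ' ω ≤ (j : WithTop ℕ) ∧ (j : WithTop ℕ) < τ ω}.indicator (fun _ => (1 : ℝ)) ω
        * diff (fun n => g n ω) (j + 1) := by
    funext j ω
    simp [localIncr, Set.indicator_apply]
  rw [heq]
  refine (mds_diff hg).mul (fun j => measurable_const.indicator (hS j)) fun j => ?_
  refine (((mds_diff hg).int j).indicator (ℱ.le j _ (hS j))).congr (.of_forall fun ω => ?_)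
  simp [Set.indicator_apply]

/-- On the active set `τ'` takes one of the values `a ≤ j`, and for each of them both `{τ' = a}` and
`F a j` are `ℱ j`-measurable. -/
theorem measurable_localIntegrand {F : ℕ → ℕ → Ω → ℝ} (hF : AdaptedTwo ℱ F)
    {τ' τ : Ω → WithTop ℕ} (hτ' : IsStoppingTime ℱ τ') (hτ : IsStoppingTime ℱ τ) (j : ℕ) :
    Measurable[ℱ j] fun ω => localIntegrand (fun s t => F s t ω) (τ' ω) (τ ω) j := by
  have heq : (fun ω => localIntegrand (fun s t => F s t ω) (τ' ω) (τ ω) j) = fun ω =>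
      ∑ a ∈ Finset.range (j + 1),
        ({ω | τ' ω = (a : WithTop ℕ)} ∩ {ω | (j : WithTop ℕ) < τ ω}).indicator (F a j) ω := by
    funext ω
    by_cases h1 : τ' ω ≤ (j : WithTop ℕ)
    · obtain ⟨ha, haj⟩ := eq_cast_untopD h1
      rw [Finset.sum_eq_single ((τ' ω).untopD 0)]
      · by_cases h2 : (j : WithTop ℕ) < τ ω
        · have hmem : ω ∈ {ω' | τ' ω' = (((τ' ω).untopD 0 : ℕ) : WithTop ℕ)}
              ∩ {ω' | (j : WithTop ℕ) < τ ω'} := ⟨ha, h2⟩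
          rw [Set.indicator_of_mem hmem, localIntegrand, if_pos ⟨h1, h2⟩]
        · rw [Set.indicator_of_notMem fun h => h2 h.2, localIntegrand, if_neg fun h => h2 h.2]
      · intro b _ hb
        refine Set.indicator_of_notMem (fun h => hb ?_) _
        have h3 : τ' ω = (b : WithTop ℕ) := h.1
        rw [h3]
        rfl
      · intro h
        exact absurd (Finset.mem_range.2 (by omega)) h
    · rw [localIntegrand, if_neg fun h => h1 h.1]
      symm
      refine Finset.sum_eq_zero fun a ha => Set.indicator_of_notMem (fun h => h1 ?_) _
      have h3 : τ' ω = (a : WithTop ℕ) := h.1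
      rw [h3]
      exact_mod_cast Nat.lt_succ_iff.1 (Finset.mem_range.1 ha)
  rw [heq]
  refine @Finset.measurable_sum _ _ _ _ _ _ (ℱ j) _ _ fun a ha => ?_
  have haj : a ≤ j := Nat.lt_succ_iff.1 (Finset.mem_range.1 ha)
  refine (hF a j haj).indicator (MeasurableSet.inter ?_ (hτ.measurableSet_gt j))
  exact ℱ.mono haj _ (hτ'.measurableSet_eq a)

/-- Needed to apply Minkowski's inequality in the two-parameter estimate. Splitting by the value of
`τ'` turns the expression into a countable supremum with deterministic indices. -/
theorem measurable_supParaprod_delta {F : ℕ → ℕ → Ω → ℝ} (hF : AdaptedTwo ℱ F)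
    {g : ℕ → Ω → ℝ} (hg : Martingale g ℱ P) {τ' τ : Ω → WithTop ℕ}
    (hτ' : IsStoppingTime ℱ τ') (hτ : IsStoppingTime ℱ τ) :
    Measurable fun ω => supParaprod (deltaFst ((τ' ω).untopD 0) fun s t => F s t ω)
      (fun n => g n ω) (τ' ω) (τ ω) := by
  have hgm : ∀ n, Measurable (g n) := fun n => (hg.1 n).measurable.mono (ℱ.le n) le_rfl
  have hFm : ∀ s t, s ≤ t → Measurable (F s t) := fun s t h => (hF s t h).mono (ℱ.le t) le_rfl
  have heq : (fun ω => supParaprod (deltaFst ((τ' ω).untopD 0) fun s t => F s t ω)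
      (fun n => g n ω) (τ' ω) (τ ω)) = fun ω => ⨆ (s : ℕ) (t : ℕ) (a : ℕ) (_ : a ≤ s ∧ s < t),
        ({ω | τ' ω = (a : WithTop ℕ)} ∩ {ω | (t : WithTop ℕ) ≤ τ ω}).indicator
          (fun ω => ‖paraprod (deltaFst a fun s t => F s t ω) (fun n => g n ω) s t‖ₑ) ω := by
    funext ω
    refine le_antisymm ?_ ?_
    · refine iSup_le fun s => iSup₂_le fun t h => ?_
      obtain ⟨has, hst, htb⟩ := h
      obtain ⟨ha, has'⟩ := eq_cast_untopD has
      refine le_iSup₂_of_le s t (le_iSup₂_of_le ((τ' ω).untopD 0) ⟨has', hst⟩ ?_)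
      have hmem : ω ∈ {ω' | τ' ω' = (((τ' ω).untopD 0 : ℕ) : WithTop ℕ)}
          ∩ {ω' | (t : WithTop ℕ) ≤ τ ω'} := ⟨ha, htb⟩
      rw [Set.indicator_of_mem hmem]
    · refine iSup₂_le fun s t => iSup₂_le fun a h => ?_
      by_cases hω : ω ∈ {ω | τ' ω = (a : WithTop ℕ)} ∩ {ω | (t : WithTop ℕ) ≤ τ ω}
      swap
      · rw [Set.indicator_of_notMem hω]
        exact zero_le
      rw [Set.indicator_of_mem hω]
      have h1 : τ' ω = (a : WithTop ℕ) := hω.1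
      have h2 : (t : WithTop ℕ) ≤ τ ω := hω.2
      have h3 : (τ' ω).untopD 0 = a := by rw [h1]; rfl
      have h4 : τ' ω ≤ (s : WithTop ℕ) := by rw [h1]; exact_mod_cast h.1
      rw [h3]
      exact le_iSup_of_le s (le_iSup₂_of_le (f := fun t _ =>
        ‖paraprod (deltaFst a fun s t => F s t ω) (fun n => g n ω) s t‖ₑ) t ⟨h4, h.2, h2⟩ le_rfl)
  rw [heq]
  refine Measurable.iSup fun s => Measurable.iSup fun t => Measurable.iSup fun a =>
    Measurable.iSup fun h => Measurable.indicator (Measurable.enorm ?_) (MeasurableSet.inter ?_ ?_)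
  · refine Finset.measurable_sum _ fun j hj => ?_
    rw [Finset.mem_Ioc] at hj
    refine Measurable.mul ?_ ((hgm _).sub (hgm _))
    exact (hFm a (j - 1) (by omega)).sub (hFm s (j - 1) (by omega))
  · exact ℱ.le a _ (hτ'.measurableSet_eq a)
  · exact ℱ.le t _ (hτ.measurableSet_ge t)

end Localization

/-! ### Assembly of the theorem -/

/-- The estimate with the left endpoint fixed, for the measurable majorant of the maximal
paraproduct. -/
theorem exists_eLpNorm_local_le.{u} {q q₀ q₁ r r₀ r₁ : ℝ≥0∞}
    (hq : q ≠ 0) (hq' : q ≠ ∞) (hq₁ : q₁ ≠ 0) (hq₀ : 1 ≤ q₀) (hq₀' : q₀ ≠ ∞)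
    (hr : 1 ≤ r) (hr' : r ≠ ∞) (hr₀ : 1 ≤ r₀) (hr₀' : r₀ ≠ ∞) (hr₁ : 1 ≤ r₁)
    (hqq : 1 / q = 1 / q₀ + 1 / q₁) (hrr : 1 / r = 1 / r₀ + 1 / r₁) :
    ∃ C : ℝ≥0, ∀ (Ω : Type u) [m : MeasurableSpace Ω] (P : Measure Ω) [IsProbabilityMeasure P]
      (ℱ : Filtration ℕ m) (g : ℤ → ℕ → Ω → ℝ) (F : ℤ → ℕ → ℕ → Ω → ℝ)
      (τ' τ : ℤ → Ω → WithTop ℕ),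
      (∀ k, Martingale (g k) ℱ P) →
      (∀ k, AdaptedTwo ℱ (F k)) →
      (∀ k, IsStoppingTime ℱ (τ' k)) →
      (∀ k, IsStoppingTime ℱ (τ k)) →
      eLpNorm (fun ω => ellNorm r fun k => ⨆ N, maxSum (fun j =>
          localIntegrand (fun s t => F k s t ω) (τ' k ω) (τ k ω) j
            * localIncr (fun n => g k n ω) (τ' k ω) (τ k ω) j) N) q P
        ≤ C * eLpNorm (fun ω => ellNorm r₁ fun k =>
              supFrom (fun s t => F k s t ω) (τ' k ω) (τ k ω)) q₁ P
            * eLpNorm (fun ω => ellNorm r₀ fun k =>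
              sqFun (fun n => g k n ω) (τ' k ω) (τ k ω)) q₀ P := by
  obtain ⟨C, hC⟩ := exists_eLpNorm_transform_le.{u, 0} hq hq' hq₁ hq₀ hq₀' hr hr' hr₀ hr₀' hr₁ hqq
    hrr
  refine ⟨C, fun Ω m P _ ℱ g F τ' τ hg hF hτ' hτ => ?_⟩
  have hr0 : r ≠ 0 := (zero_lt_one.trans_le hr).ne'
  let d : ℤ → ℕ → Ω → ℝ := fun k j ω => localIncr (fun n => g k n ω) (τ' k ω) (τ k ω) j
  let f : ℤ → ℕ → Ω → ℝ := fun k j ω => localIntegrand (fun s t => F k s t ω) (τ' k ω) (τ k ω) j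
  have hd : ∀ k, MDS ℱ P (d k) := fun k => mds_localIncr (hg k) (hτ' k) (hτ k)
  have hf : ∀ k j, Measurable[ℱ j] (f k j) := fun k j =>
    measurable_localIntegrand (hF k) (hτ' k) (hτ k) j
  refine (eLpNorm_ennreal_mono fun ω => ellNorm_iSup_le hr0 hr' fun k => maxSum_mono _).trans ?_
  refine eLpNorm_iSup_le hq hq' (fun N => ?_) (fun ω M N hMN => ?_) fun N => ?_
  · exact measurable_ellNorm fun k => measurable_maxSum fun j _ =>
      ((hf k j).mono (ℱ.le _) le_rfl).mul (((hd k).meas j).mono (ℱ.le _) le_rfl)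
  · have hsub : Finset.Icc (-M : ℤ) M ⊆ Finset.Icc (-N : ℤ) N := by
      have : (M : ℤ) ≤ N := by exact_mod_cast hMN
      exact Finset.Icc_subset_Icc (by linarith) this
    refine le_trans (ellNorm_mono fun k => maxSum_mono _ hMN) ?_
    exact ellNorm_comp_le (φ := Set.inclusion hsub) (Set.inclusion_injective hsub)
      fun k : Finset.Icc (-N : ℤ) N => maxSum (fun j => f k j ω * d k j ω) N
  · refine (hC (Finset.Icc (-N : ℤ) N) Ω P ℱ (fun k => d k) (fun k => f k) (fun k => hd k)
      (fun k => hf k) N).trans ?_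
    gcongr
    · refine eLpNorm_ennreal_mono fun ω => ?_
      refine le_trans (ellNorm_mono fun k => maxAbs_localIntegrand_le _ _ _ N) ?_
      exact ellNorm_comp_le (φ := Subtype.val) Subtype.val_injective
        fun k => supFrom (fun s t => F k s t ω) (τ' k ω) (τ k ω)
    · refine eLpNorm_ennreal_mono fun ω => ?_
      refine le_trans (ellNorm_mono fun k => sqPart_localIncr_le _ _ _ N) ?_
      exact ellNorm_comp_le (φ := Subtype.val) Subtype.val_injective
        fun k => sqFun (fun n => g k n ω) (τ' k ω) (τ k ω)

end VVParaproduct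

open VVParaproduct in
theorem theorem2p6 (q q₀ q₁ r r₀ r₁ : ℝ≥0∞)
    (hq : 0 < q) (hq₁ : 0 < q₁) (hq₀ : 1 ≤ q₀) (hq₀' : q₀ < ∞)
    (hr : 1 ≤ r) (hr' : r < ∞) (hr₀ : 1 ≤ r₀) (hr₀' : r₀ < ∞) (hr₁ : 1 ≤ r₁)
    (hqq : 1 / q = 1 / q₀ + 1 / q₁) (hrr : 1 / r = 1 / r₀ + 1 / r₁) :
    ∃ C : ℝ≥0, ∀ (Ω : Type*) [m : MeasurableSpace Ω] (P : Measure Ω) [IsProbabilityMeasure P]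
      (ℱ : Filtration ℕ m) (g : ℤ → ℕ → Ω → ℝ) (F : ℤ → ℕ → ℕ → Ω → ℝ)
      (τ' τ : ℤ → Ω → WithTop ℕ),
      (∀ k, Martingale (g k) ℱ P) →
      (∀ k, AdaptedTwo ℱ (F k)) →
      (∀ k, IsStoppingTime ℱ (τ' k)) →
      (∀ k, IsStoppingTime ℱ (τ k)) →
      (∀ k ω, τ' k ω ≤ τ k ω) →
      -- the estimate with the left endpoint fixed at `τ'_k`
      eLpNorm (fun ω => ellNorm r fun k =>
          supParaprodFrom (fun s t => F k s t ω) (fun n => g k n ω) (τ' k ω) (τ k ω)) q P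
        ≤ C * eLpNorm (fun ω => ellNorm r₁ fun k =>
              supFrom (fun s t => F k s t ω) (τ' k ω) (τ k ω)) q₁ P
            * eLpNorm (fun ω => ellNorm r₀ fun k =>
              sqFun (fun n => g k n ω) (τ' k ω) (τ k ω)) q₀ P
      ∧
      -- the estimate with the two-parameter supremum, for `q ≥ 1`
      (1 ≤ q →
        eLpNorm (fun ω => ellNorm r fun k =>
            supParaprod (fun s t => F k s t ω) (fun n => g k n ω) (τ' k ω) (τ k ω)) q P
          ≤ eLpNorm (fun ω => ellNorm r fun k =>
              supParaprod (deltaFst ((τ' k ω).untopD 0) fun s t => F k s t ω)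
                (fun n => g k n ω) (τ' k ω) (τ k ω)) q P
            + C * eLpNorm (fun ω => ellNorm r₁ fun k =>
                supTwo (fun s t => F k s t ω) (τ' k ω) (τ k ω)) q₁ P
              * eLpNorm (fun ω => ellNorm r₀ fun k =>
                sqFun (fun n => g k n ω) (τ' k ω) (τ k ω)) q₀ P)
      ∧
      -- the same for `q < 1`, where the triangle inequality holds for the `q`-th power of the
      -- `L^q` quasinorm
      (q < 1 →
        (eLpNorm (fun ω => ellNorm r fun k =>
            supParaprod (fun s t => F k s t ω) (fun n => g k n ω) (τ' k ω) (τ k ω)) q P)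
            ^ q.toReal
          ≤ (eLpNorm (fun ω => ellNorm r fun k =>
              supParaprod (deltaFst ((τ' k ω).untopD 0) fun s t => F k s t ω)
                (fun n => g k n ω) (τ' k ω) (τ k ω)) q P) ^ q.toReal
            + (C * eLpNorm (fun ω => ellNorm r₁ fun k =>
                supTwo (fun s t => F k s t ω) (τ' k ω) (τ k ω)) q₁ P
              * eLpNorm (fun ω => ellNorm r₀ fun k =>
                sqFun (fun n => g k n ω) (τ' k ω) (τ k ω)) q₀ P) ^ q.toReal) := by
  -- `1/q ≥ 1/q₀ > 0`.
  have hq_top : q ≠ ∞ := by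
    rintro rfl
    have h0 : 1 / q₀ = 0 := by
      rw [ENNReal.div_top] at hqq
      exact (add_eq_zero.1 hqq.symm).1
    simp [hq₀'.ne] at h0
  have hr0 : r ≠ 0 := (zero_lt_one.trans_le hr).ne'
  obtain ⟨C, hC⟩ := exists_eLpNorm_local_le hq.ne' hq_top hq₁.ne' hq₀ hq₀'.ne hr hr'.ne hr₀ hr₀'.ne
    hr₁ hqq hrr
  -- The factor 2 is that of `supParaprod_le`; the first estimate would hold with `C` alone.
  refine ⟨2 * C, fun Ω m P _ ℱ g F τ' τ hg hF hτ' hτ _ => ?_⟩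
  have hmain := hC Ω P ℱ g F τ' τ hg hF hτ' hτ
  let X : ℤ → Ω → ℝ≥0∞ := fun k ω => ⨆ N, maxSum (fun j =>
    localIntegrand (fun s t => F k s t ω) (τ' k ω) (τ k ω) j
      * localIncr (fun n => g k n ω) (τ' k ω) (τ k ω) j) N
  have hXm : Measurable fun ω => ellNorm r fun k => X k ω :=
    measurable_ellNorm fun k => Measurable.iSup fun N => measurable_maxSum fun j _ =>
      ((measurable_localIntegrand (hF k) (hτ' k) (hτ k) j).mono (ℱ.le _) le_rfl).mul
        (((mds_localIncr (hg k) (hτ' k) (hτ k)).meas j).mono (ℱ.le _) le_rfl)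
  have hDm : Measurable fun ω => ellNorm r fun k =>
      supParaprod (deltaFst ((τ' k ω).untopD 0) fun s t => F k s t ω)
        (fun n => g k n ω) (τ' k ω) (τ k ω) :=
    measurable_ellNorm fun k => measurable_supParaprod_delta (hF k) (hg k) (hτ' k) (hτ k)
  have hfrom : ∀ k ω, supParaprodFrom (fun s t => F k s t ω) (fun n => g k n ω) (τ' k ω) (τ k ω)
      ≤ X k ω := fun k ω => supParaprodFrom_le _ _ _ _
  have hpoint : ∀ ω, (ellNorm r fun k =>
      supParaprod (fun s t => F k s t ω) (fun n => g k n ω) (τ' k ω) (τ k ω))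
      ≤ (ellNorm r fun k => supParaprod (deltaFst ((τ' k ω).untopD 0) fun s t => F k s t ω)
          (fun n => g k n ω) (τ' k ω) (τ k ω)) + (2 : ℝ≥0) * ellNorm r fun k => X k ω := by
    intro ω
    rw [← ellNorm_const_mul hr0]
    refine le_trans (ellNorm_mono fun k => ?_) (ellNorm_add_le hr _ _)
    refine (supParaprod_le _ _ _ _).trans (add_le_add le_rfl ?_)
    exact mul_le_mul' (by simp) (hfrom k ω)
  have h2X : eLpNorm (fun ω => (2 : ℝ≥0) * ellNorm r fun k => X k ω) q P
      ≤ (2 * C : ℝ≥0) * eLpNorm (fun ω => ellNorm r₁ fun k =>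
            supFrom (fun s t => F k s t ω) (τ' k ω) (τ k ω)) q₁ P
          * eLpNorm (fun ω => ellNorm r₀ fun k =>
            sqFun (fun n => g k n ω) (τ' k ω) (τ k ω)) q₀ P := by
    rw [eLpNorm_ennreal_const_mul, ENNReal.coe_mul, mul_assoc, mul_assoc, ← mul_assoc (C : ℝ≥0∞)]
    gcongr
  have htwo : eLpNorm (fun ω => ellNorm r₁ fun k =>
        supFrom (fun s t => F k s t ω) (τ' k ω) (τ k ω)) q₁ P
      ≤ eLpNorm (fun ω => ellNorm r₁ fun k =>
        supTwo (fun s t => F k s t ω) (τ' k ω) (τ k ω)) q₁ P :=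
    eLpNorm_ennreal_mono fun ω => ellNorm_mono fun k => supFrom_le_supTwo _ _ _
  refine ⟨?_, fun hq1 => ?_, fun hq1 => ?_⟩
  · refine le_trans (eLpNorm_ennreal_mono fun ω => ?_) h2X
    refine (ellNorm_mono fun k => hfrom k ω).trans ?_
    exact le_mul_of_one_le_left' (by simp)
  · refine (eLpNorm_ennreal_mono hpoint).trans ?_
    refine (eLpNorm_ennreal_add_le hq1 hDm.aemeasurable (hXm.const_mul _).aemeasurable).trans ?_
    refine add_le_add le_rfl (h2X.trans ?_)
    gcongr
  · have hq0 : 0 < q.toReal := ENNReal.toReal_pos hq.ne' hq_top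
    have hq1' : q.toReal ≤ 1 := by simpa using ENNReal.toReal_mono ENNReal.one_ne_top hq1.le
    refine le_trans (ENNReal.rpow_le_rpow (eLpNorm_ennreal_mono hpoint) hq0.le) ?_
    rw [eLpNorm_ennreal_rpow hq.ne' hq_top]
    -- Subadditivity of `x ↦ x^q` for `q ≤ 1` keeps the constant 1 in front of the `δF` term.
    refine (lintegral_mono fun ω => ENNReal.rpow_add_le_add_rpow _ _ hq0.le hq1').trans ?_
    rw [lintegral_add_right _ ((hXm.const_mul _).pow_const _), ← eLpNorm_ennreal_rpow hq.ne' hq_top,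
      ← eLpNorm_ennreal_rpow hq.ne' hq_top]
    refine add_le_add le_rfl (ENNReal.rpow_le_rpow (h2X.trans ?_) hq0.le)
    gcongr
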